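/- Conventions. A monoid is a commutative monoid $A$ with $1$ and an absorbing element $0$; an $A$-module is a pointed set $(M,*)$ with an action of $A$ such that $0\cdot m=*$ for all $m$, and morphisms of modules are pointed equivariant maps. $M$ is finitely generated if there are finitely many $m_1,\dots,m_n\in M$ such that every $m\in M$ is of the form $a\cdot m_i$. $\mathrm{MSpec}\,A$ is the space of (proper) prime ideals of $A$ with its structure sheaf, whose stalk at $\mathfrak p$ is $A_{\mathfrak p}$; a monoid scheme is a space with a sheaf of monoids that is locally isomorphic to some $\mathrm{MSpec}\,A$, and it is of finite type if it has a finite covering by open subspaces isomorphic to spectra of finitely generated monoids. For an $A$-module $M$, $\widetilde M$ is the associated sheaf of modules on $\mathrm{MSpec}\,A$, with stalks $M_{\mathfrak p}$. An $\mathcal O_X$-module $\mathcal F$ on a monoid scheme $X$ is quasicoherent (coherent) if every point has an affine open neighbourhood $U\cong\mathrm{MSpec}\,A$ with $\mathcal F|_U\cong\widetilde M$ for some (finitely generated) $A$-module $M$; $\mathrm{Qcoh}(X)$ and $\mathrm{Coh}(X)$ are the full subcategories of $\mathcal O_X$-modules of this kind. A pointed category with two classes of morphisms $\mathfrak M$ (admissible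 monos) and $\mathfrak E$ (admissible epis) is proto-exact (in the sense of Dyckerhoff–Kapranov) if: (i) all $0\to A$ are in $\mathfrak M$ and all $A\to 0$ are in $\mathfrak E$; (ii) both classes contain the isomorphisms and are closed under composition; (iii) a commutative square with two parallel sides in $\mathfrak M$ and the other two in $\mathfrak E$ is Cartesian if and only if it is co-Cartesian; (iv) every diagram $X'\twoheadleftarrow X\hookrightarrow Y$ and (v) every diagram $X'\hookrightarrow Y'\twoheadleftarrow Y$ (with $\hookrightarrow$ in $\mathfrak M$, $\twoheadrightarrow$ in $\mathfrak E$) can be completed to a biCartesian square of this kind. An admissible short exact sequence $X\hookrightarrow Y\twoheadrightarrow Z$ is such a biCartesian square whose fourth corner is $0$, and a functor is exact if it preserves these. An exact equivalence is an equivalence of categories that preserves and reflects admissible short exact sequences. For $A$-modules, $\mathfrak M$ consists of the injective morphisms, and $\mathfrak E$ of the surjective morphisms $f$ whose restriction to the complement of $f^{-1}(*)$ is injective. For $\mathcal O_X$-modules, a morphism is in $\mathfrak M$ (in $\mathfrak E$) if all the maps that it induces on stalks are in $\mathfrak M$ (in $\mathfrak E$). Subcategories carry the induced classes. **Proposition.**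 Let $X$ be a monoid scheme of finite type. 1. $(\mathrm{Qcoh}(X),\mathfrak M,\mathfrak E)$ and $(\mathrm{Coh}(X),\mathfrak M,\mathfrak E)$ are proto-exact. 2. Let $Z\subset X$ be a closed subset. The full subcategories $\mathrm{Qcoh}(X)_Z$ and $\mathrm{Coh}(X)_Z$ of sheaves $\mathcal F$ with $\{x\in X:\mathcal F_x\neq 0\}\subset Z$ are proto-exact. 3. Let $\mathcal I\subset\mathcal O_X$ be a quasicoherent sheaf of ideals. The full subcategories $\mathrm{Qcoh}(X)_{\mathcal I}\subset\mathrm{Qcoh}(X)$ and $\mathrm{Coh}(X)_{\mathcal I}\subset\mathrm{Coh}(X)$ of sheaves $\mathcal F$ with $\mathcal I\cdot\mathcal F=0$ are proto-exact, and their inclusion functors are exact. 4. If $X=\mathrm{MSpec}\,A$, then the category of $A$-modules and the category of finitely generated $A$-modules are proto-exact, the functor $M\mapsto\widetilde M$ is an exact equivalence from $A$-modules to $\mathrm{Qcoh}(X)$, and it restricts to an exact equivalence from finitely generated $A$-modules to $\mathrm{Coh}(X)$. -/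

import Mathlib

open CategoryTheory CategoryTheory.Limits TopologicalSpace Opposite

universe v₁ u₁ v₂ u₂ u

noncomputable section

/-! ## Proto-exact categories -/

/-- A pointed category `C` (a category with a zero object) with two classes of morphisms `M`
(admissible monomorphisms) and `E` (admissible epimorphisms) is proto-exact. -/
structure IsProtoExact {C : Type u₁} [Category.{v₁} C] (M E : MorphismProperty C) : Prop where
  hasZeroObject : HasZeroObject C
  mono_of_isZero : ∀ ⦃O A : C⦄ (f : O ⟶ A), IsZero O → M f
  epi_of_isZero : ∀ ⦃A O : C⦄ (f : A ⟶ O), IsZero O → E f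
  mono_comp : ∀ ⦃A B D : C⦄ (f : A ⟶ B) (g : B ⟶ D), M f → M g → M (f ≫ g)
  epi_comp : ∀ ⦃A B D : C⦄ (f : A ⟶ B) (g : B ⟶ D), E f → E g → E (f ≫ g)
  mono_of_isIso : ∀ ⦃A B : C⦄ (f : A ⟶ B), IsIso f → M f
  epi_of_isIso : ∀ ⦃A B : C⦄ (f : A ⟶ B), IsIso f → E f
  cartesian_iff_cocartesian : ∀ ⦃A B A' B' : C⦄ (i : A ⟶ B) (j : A ⟶ A') (j' : B ⟶ B')
    (i' : A' ⟶ B'), CommSq i j j' i' → M i → M i' → E j → E j' →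
      (IsPullback i j j' i' ↔ IsPushout i j j' i')
  exists_pushout : ∀ ⦃A B A' : C⦄ (i : A ⟶ B) (j : A ⟶ A'), M i → E j →
    ∃ (B' : C) (j' : B ⟶ B') (i' : A' ⟶ B'), M i' ∧ E j' ∧
      IsPullback i j j' i' ∧ IsPushout i j j' i'
  exists_pullback : ∀ ⦃B A' B' : C⦄ (j' : B ⟶ B') (i' : A' ⟶ B'), M i' → E j' →
    ∃ (A : C) (i : A ⟶ B) (j : A ⟶ A'), M i ∧ E j ∧
      IsPullback i j j' i' ∧ IsPushout i j j' i'

/-- Admissible short exact sequences `A ↪ B ↠ D`: biCartesian squares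
with top side `i : A ⟶ B`, left side `j : A ⟶ O`, right side `j' : B ⟶ D` and bottom side
`i' : O ⟶ D`, where `O` is a zero object, `i, i'` are in `M` and `j, j'` are in `E`. -/
structure IsAdmissibleShortExact {C : Type u₁} [Category.{v₁} C] (M E : MorphismProperty C)
    {A B O D : C} (i : A ⟶ B) (j : A ⟶ O) (j' : B ⟶ D) (i' : O ⟶ D) : Prop where
  isZero : IsZero O
  mono_top : M i
  mono_bot : M i'
  epi_left : E j
  epi_right : E j'
  isPullback : IsPullback i j j' i'
  isPushout : IsPushout i j j' i'

/-- A functor between categories with classes of admissible monomorphisms and epimorphisms is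
exact if it preserves admissible short exact sequences. -/
def IsExactFunctor {C : Type u₁} [Category.{v₁} C] {D : Type u₂} [Category.{v₂} D]
    (M E : MorphismProperty C) (M' E' : MorphismProperty D) (F : C ⥤ D) : Prop :=
  ∀ ⦃A B O Q : C⦄ (i : A ⟶ B) (j : A ⟶ O) (j' : B ⟶ Q) (i' : O ⟶ Q),
    IsAdmissibleShortExact M E i j j' i' →
      IsAdmissibleShortExact M' E' (F.map i) (F.map j) (F.map j') (F.map i')

/-- An exact equivalence: an equivalence of categories under which the admissible short exact
sequences correspond to each other, i.e. it preserves and reflects them. -/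
structure IsExactEquivalence {C : Type u₁} [Category.{v₁} C] {D : Type u₂} [Category.{v₂} D]
    (M E : MorphismProperty C) (M' E' : MorphismProperty D) (F : C ⥤ D) : Prop where
  isEquivalence : F.IsEquivalence
  isExact : IsExactFunctor M E M' E' F
  reflects : ∀ ⦃A B O Q : C⦄ (i : A ⟶ B) (j : A ⟶ O) (j' : B ⟶ Q) (i' : O ⟶ Q),
    IsAdmissibleShortExact M' E' (F.map i) (F.map j) (F.map j') (F.map i') →
      IsAdmissibleShortExact M E i j j' i'

/-- A map to a pointed set is an admissible surjection if it is surjective, and injective away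
from the fibre over the base point. -/
def IsAdmissibleSurjection {S T : Type*} [Zero T] (f : S → T) : Prop :=
  Function.Surjective f ∧ Set.InjOn f {s | f s ≠ 0}

/-! ## Modules over a monoid with zero

A monoid is a commutative monoid with zero (`CommMonoidWithZero`). A module over it is a pointed
set (the base point is `0`) with an action such that `0 • m = 0` (and then `a • 0 = 0`). -/

/-- Modules over the monoid `A`. -/
structure AMod (A : Type u) [CommMonoidWithZero A] where
  carrier : Type u
  [zero : Zero carrier]
  [action : MulActionWithZero A carrier]

attribute [instance] AMod.zero AMod.action

namespace AMod

variable {A : Type u} [CommMonoidWithZero A]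

/-- Equivariant maps. They are automatically pointed, see `map_zero`. -/
instance : Category (AMod A) where
  Hom M N := M.carrier →[A] N.carrier
  id M := MulActionHom.id A
  comp f g := MulActionHom.comp g f

/-- The underlying equivariant map of a morphism. -/
def Hom.toMap {M N : AMod A} (f : M ⟶ N) : M.carrier →[A] N.carrier := f

theorem map_zero {M N : Type*} [Zero M] [Zero N] [MulActionWithZero A M] [MulActionWithZero A N]
    (f : M →[A] N) : f 0 = 0 := by
  have h := map_smul f (0 : A) (0 : M)
  rwa [zero_smul, zero_smul] at h

/-- Admissible monomorphisms of modules: the injective maps. -/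
def admMono (A : Type u) [CommMonoidWithZero A] : MorphismProperty (AMod A) :=
  fun _ _ f => Function.Injective (Hom.toMap f)

/-- Admissible epimorphisms of modules. -/
def admEpi (A : Type u) [CommMonoidWithZero A] : MorphismProperty (AMod A) :=
  fun _ _ f => IsAdmissibleSurjection (Hom.toMap f)

/-- Finitely generated modules. -/
def isFG (A : Type u) [CommMonoidWithZero A] : ObjectProperty (AMod A) :=
  fun M => ∃ s : Set M.carrier, s.Finite ∧ ∀ m : M.carrier, ∃ a : A, ∃ g ∈ s, m = a • g

end AMod

/-! ## Prime spectra of monoids and localization -/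

/-- The prime spectrum of a monoid: the (proper) prime ideals. -/
@[ext]
structure MSpec (A : Type u) [CommMonoidWithZero A] where
  asIdeal : Set A
  zero_mem : 0 ∈ asIdeal
  mul_mem : ∀ (a : A) {x : A}, x ∈ asIdeal → a * x ∈ asIdeal
  one_notMem : 1 ∉ asIdeal
  mem_or_mem : ∀ {x y : A}, x * y ∈ asIdeal → x ∈ asIdeal ∨ y ∈ asIdeal

namespace MSpec

variable {A : Type u} [CommMonoidWithZero A]

/-- The complement of a prime ideal. -/
def primeCompl (p : MSpec A) : Submonoid A where
  carrier := {a | a ∉ p.asIdeal}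
  one_mem' := p.one_notMem
  mul_mem' ha hb h := (p.mem_or_mem h).elim ha hb

/-- The set `V(s)` of primes that contain `s`. -/
def zeroLocus (s : Set A) : Set (MSpec A) := {p | s ⊆ p.asIdeal}

/-- The topology whose closed sets are the sets `V(s)`. -/
instance : TopologicalSpace (MSpec A) :=
  TopologicalSpace.ofClosed (Set.range zeroLocus)
    ⟨Set.univ, Set.eq_empty_of_forall_notMem fun p hp => p.one_notMem (hp (Set.mem_univ 1))⟩
    (by
      intro T hT
      refine ⟨⋃₀ {s | zeroLocus s ∈ T}, Set.ext fun p => ⟨?_, ?_⟩⟩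
      · intro hp t ht
        obtain ⟨s, rfl⟩ := hT ht
        exact fun x hx => hp ⟨s, ht, hx⟩
      · rintro hp x ⟨s, hs, hx⟩
        exact hp _ hs hx)
    (by
      rintro _ ⟨s, rfl⟩ _ ⟨t, rfl⟩
      refine ⟨{z | ∃ x ∈ s, ∃ y ∈ t, z = x * y}, Set.ext fun p => ⟨?_, ?_⟩⟩
      · intro hp
        by_contra h
        simp only [Set.mem_union, not_or] at h
        obtain ⟨x, hx, hxp⟩ := Set.not_subset.1 h.1
        obtain ⟨y, hy, hyp⟩ := Set.not_subset.1 h.2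
        exact (p.mem_or_mem (hp ⟨x, hx, y, hy, rfl⟩)).elim hxp hyp
      · rintro hp _ ⟨x, hx, y, hy, rfl⟩
        rcases hp with hp | hp
        · rw [mul_comm]
          exact p.mul_mem y (hp hx)
        · exact p.mul_mem x (hp hy))

theorem isClosed_iff (Z : Set (MSpec A)) : IsClosed Z ↔ ∃ s, zeroLocus s = Z := by
  rw [← isOpen_compl_iff]
  change Zᶜᶜ ∈ Set.range zeroLocus ↔ _
  rw [compl_compl]
  rfl

end MSpec

section Localization

variable {A : Type u} [CommMonoidWithZero A] (S : Submonoid A)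

theorem OreLocalization.zero_oreDiv_of_mulActionWithZero {M : Type*} [Zero M]
    [MulActionWithZero A M] (s : S) : (0 : M) /ₒ s = 0 := by
  rw [OreLocalization.zero_def, OreLocalization.oreDiv_eq_iff]
  exact ⟨s, 1, by simp [Submonoid.smul_def, smul_zero], by simp⟩

/-- `S⁻¹M` as a module over `S⁻¹A`. -/
instance OreLocalization.mulActionWithZero {M : Type*} [Zero M] [MulActionWithZero A M] :
    MulActionWithZero (OreLocalization S A) (OreLocalization S M) where
  smul_zero x := by
    induction x using OreLocalization.ind with
    | _ a s =>
      rw [OreLocalization.zero_def, OreLocalization.smul_div_one, smul_zero,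
        OreLocalization.zero_oreDiv_of_mulActionWithZero, ← OreLocalization.zero_def]
  zero_smul x := by
    induction x using OreLocalization.ind with
    | _ m s =>
      rw [OreLocalization.zero_def,
        OreLocalization.oreDiv_smul_char (0 : A) m 1 s 0 1 (by simp), zero_smul,
        OreLocalization.zero_oreDiv_of_mulActionWithZero]

/-- The map `m / s ↦ f m / s` of localizations. -/
def OreLocalization.mapActionHom {M N : Type*} [MulAction A M] [MulAction A N] (f : M →[A] N) :
    OreLocalization S M → OreLocalization S N :=
  OreLocalization.liftExpand (fun m s => f m /ₒ s) fun m t s ht => by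
    rw [map_smul]
    exact OreLocalization.expand (f m) s t ht

end Localization

/-! ## Monoidal spaces and sheaves of modules -/

/-- A monoidal space: a topological space with a sheaf of commutative monoids with zero. -/
structure MonoidalSpace where
  carrier : TopCat.{u}
  sheaf : TopCat.Sheaf (Type u) carrier
  monoid (U : Opens carrier) : CommMonoidWithZero (sheaf.presheaf.obj (op U))
  res_zero {U V : Opens carrier} (i : V ⟶ U) : sheaf.presheaf.map i.op 0 = 0
  res_one {U V : Opens carrier} (i : V ⟶ U) : sheaf.presheaf.map i.op 1 = 1
  res_mul {U V : Opens carrier} (i : V ⟶ U) (a b : sheaf.presheaf.obj (op U)) :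
    sheaf.presheaf.map i.op (a * b) = sheaf.presheaf.map i.op a * sheaf.presheaf.map i.op b

namespace MonoidalSpace

/-- Sections of the structure sheaf. -/
abbrev Γ (X : MonoidalSpace.{u}) (U : Opens X.carrier) : Type u := X.sheaf.presheaf.obj (op U)

instance (X : MonoidalSpace.{u}) (U : Opens X.carrier) : CommMonoidWithZero (X.Γ U) := X.monoid U

/-- Restriction of sections of the structure sheaf. -/
def res (X : MonoidalSpace.{u}) {U V : Opens X.carrier} (i : V ⟶ U) : X.Γ U → X.Γ V :=
  X.sheaf.presheaf.map i.op

end MonoidalSpace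

/-- Sheaves of modules over the structure sheaf of a monoidal space. -/
structure OMod (X : MonoidalSpace.{u}) where
  sheaf : TopCat.Sheaf (Type u) X.carrier
  zero (U : Opens X.carrier) : Zero (sheaf.presheaf.obj (op U))
  action (U : Opens X.carrier) : MulActionWithZero (X.Γ U) (sheaf.presheaf.obj (op U))
  res_zero {U V : Opens X.carrier} (i : V ⟶ U) : sheaf.presheaf.map i.op 0 = 0
  res_smul {U V : Opens X.carrier} (i : V ⟶ U) (a : X.Γ U) (s : sheaf.presheaf.obj (op U)) :
    sheaf.presheaf.map i.op (a • s) = X.res i a • sheaf.presheaf.map i.op s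

namespace OMod

variable {X : MonoidalSpace.{u}}

/-- Sections of a sheaf of modules. -/
abbrev Γ (F : OMod X) (U : Opens X.carrier) : Type u := F.sheaf.presheaf.obj (op U)

instance (F : OMod X) (U : Opens X.carrier) : Zero (F.Γ U) := F.zero U

instance (F : OMod X) (U : Opens X.carrier) : MulActionWithZero (X.Γ U) (F.Γ U) := F.action U

/-- Restriction of sections. -/
def res (F : OMod X) {U V : Opens X.carrier} (i : V ⟶ U) : F.Γ U → F.Γ V :=
  F.sheaf.presheaf.map i.op

/-- Morphisms of sheaves of modules: morphisms of sheaves of pointed sets that commute with the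
action. -/
@[ext]
structure Hom (F G : OMod X) where
  hom : F.sheaf.presheaf ⟶ G.sheaf.presheaf
  map_zero (U : Opens X.carrier) : hom.app (op U) (0 : F.Γ U) = (0 : G.Γ U)
  map_smul (U : Opens X.carrier) (a : X.Γ U) (s : F.Γ U) :
    hom.app (op U) (a • s) = a • (hom.app (op U) s : G.Γ U)

instance : Category (OMod X) where
  Hom F G := Hom F G
  id F := { hom := 𝟙 _, map_zero := fun _ => rfl, map_smul := fun _ _ _ => rfl }
  comp f g :=
    { hom := f.hom ≫ g.hom
      map_zero := fun U => by
        rw [NatTrans.comp_app, ConcreteCategory.comp_apply, f.map_zero, g.map_zero]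
      map_smul := fun U a s => by
        rw [NatTrans.comp_app, ConcreteCategory.comp_apply, f.map_smul, g.map_smul]
        rfl }

/-- The underlying morphism of presheaves of sets. -/
def presheafHom {F G : OMod X} (f : F ⟶ G) : F.sheaf.presheaf ⟶ G.sheaf.presheaf := Hom.hom f

/-- The map on sections over `U`. -/
def app {F G : OMod X} (f : F ⟶ G) (U : Opens X.carrier) : F.Γ U → G.Γ U :=
  (presheafHom f).app (op U)

/-- The stalk at a point. -/
abbrev stalk (F : OMod X) (x : X.carrier) : Type u := F.sheaf.presheaf.stalk x

/-- The base point of the stalk is the germ of the zero section. -/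
instance (F : OMod X) (x : X.carrier) : Zero (F.stalk x) :=
  ⟨F.sheaf.presheaf.germ ⊤ x (Opens.mem_top x) (0 : F.Γ ⊤)⟩

/-- The map on stalks. -/
def stalkMap {F G : OMod X} (f : F ⟶ G) (x : X.carrier) : F.stalk x → G.stalk x :=
  (TopCat.Presheaf.stalkFunctor (Type u) x).map (presheafHom f)

/-- Admissible monomorphisms: injective on all stalks. -/
def admMono (X : MonoidalSpace.{u}) : MorphismProperty (OMod X) :=
  fun _ _ f => ∀ x, Function.Injective (stalkMap f x)

/-- Admissible epimorphisms: on all stalks surjective, and injective away from the fibre over the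
base point. -/
def admEpi (X : MonoidalSpace.{u}) : MorphismProperty (OMod X) :=
  fun _ _ f => ∀ x, IsAdmissibleSurjection (stalkMap f x)

/-- The support. -/
def support (F : OMod X) : Set X.carrier := {x | ∃ s : F.stalk x, s ≠ 0}

/-- The structure sheaf as a sheaf of modules over itself. -/
def structureModule (X : MonoidalSpace.{u}) : OMod X where
  sheaf := X.sheaf
  zero U := inferInstanceAs (Zero (X.Γ U))
  action U := inferInstanceAs (MulActionWithZero (X.Γ U) (X.Γ U))
  res_zero i := X.res_zero i
  res_smul i a s := X.res_mul i a s

end OMod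

/-! ## The sheaf `M~` on the spectrum of a monoid -/

section Tilde

variable (A : Type u) [CommMonoidWithZero A] (M : Type u) [Zero M] [MulActionWithZero A M]

/-- The localization of `M` at the prime ideal `p`. -/
abbrev localizationAt (p : MSpec A) : Type u := OreLocalization p.primeCompl M

/-- A family of elements of the localizations `M_p` is a fraction `m / f` with `f` outside of all
the primes considered. -/
def isFractionPrelocal :
    TopCat.PrelocalPredicate (X := TopCat.of (MSpec A)) (localizationAt A M) where
  pred {U} s := ∃ (m : M) (f : A), ∀ p : U, ∃ hf : f ∈ p.1.primeCompl, s p = m /ₒ ⟨f, hf⟩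
  res i _ h := by
    obtain ⟨m, f, h⟩ := h
    exact ⟨m, f, fun p => h ⟨p.1, i.le p.2⟩⟩

/-- A family of elements of the localizations `M_p` is locally a fraction. -/
abbrev isLocallyFraction :
    TopCat.LocalPredicate (X := TopCat.of (MSpec A)) (localizationAt A M) :=
  (isFractionPrelocal A M).sheafify

/-- The sections of `M~` over `U`: families of elements of `M_p`, `p ∈ U`, that are locally
fractions. -/
abbrev tildeSections (U : Opens (TopCat.of (MSpec A))) : Type u :=
  {s : ∀ p : U, localizationAt A M p.1 // (isLocallyFraction A M).pred s}

variable {A M}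

theorem isLocallyFraction_of_isFraction {U : Opens (TopCat.of (MSpec A))}
    {s : ∀ p : U, localizationAt A M p.1} (h : (isFractionPrelocal A M).pred s) :
    (isLocallyFraction A M).pred s :=
  TopCat.PrelocalPredicate.sheafifyOf h

theorem isLocallyFraction_smul {U : Opens (TopCat.of (MSpec A))}
    {a : ∀ p : U, localizationAt A A p.1} {s : ∀ p : U, localizationAt A M p.1}
    (ha : (isLocallyFraction A A).pred a) (hs : (isLocallyFraction A M).pred s) :
    (isLocallyFraction A M).pred fun p => a p • s p := by
  intro p
  obtain ⟨V, hpV, i, b, f, hV⟩ := ha p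
  obtain ⟨W, hpW, j, m, g, hW⟩ := hs p
  refine ⟨V ⊓ W, ⟨hpV, hpW⟩, Opens.infLELeft V W ≫ i, b • m, g * f, fun q => ?_⟩
  obtain ⟨hf, e₁⟩ := hV ⟨q.1, q.2.1⟩
  obtain ⟨hg, e₂⟩ := hW ⟨q.1, q.2.2⟩
  refine ⟨mul_mem hg hf, ?_⟩
  have e₁' : a ⟨q.1, i.le q.2.1⟩ = b /ₒ ⟨f, hf⟩ := e₁
  have e₂' : s ⟨q.1, i.le q.2.1⟩ = m /ₒ ⟨g, hg⟩ := e₂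
  change a ⟨q.1, i.le q.2.1⟩ • s ⟨q.1, i.le q.2.1⟩ = _
  rw [e₁', e₂', OreLocalization.oreDiv_smul_char b m ⟨f, hf⟩ ⟨g, hg⟩ b ⟨g, hg⟩ (mul_comm _ _)]
  rfl

instance tildeSections.instZero (U : Opens (TopCat.of (MSpec A))) : Zero (tildeSections A M U) :=
  ⟨⟨fun _ => 0, isLocallyFraction_of_isFraction
    ⟨0, 1, fun _ => ⟨one_mem _, OreLocalization.zero_def⟩⟩⟩⟩

instance tildeSections.instMonoid (U : Opens (TopCat.of (MSpec A))) :
    CommMonoidWithZero (tildeSections A A U) where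
  one := ⟨fun _ => 1, isLocallyFraction_of_isFraction
    ⟨1, 1, fun _ => ⟨one_mem _, OreLocalization.one_def⟩⟩⟩
  mul a b := ⟨fun p => a.1 p * b.1 p, isLocallyFraction_smul a.2 b.2⟩
  mul_assoc a b c := Subtype.ext (funext fun p => mul_assoc (a.1 p) (b.1 p) (c.1 p))
  one_mul a := Subtype.ext (funext fun p => one_mul (a.1 p))
  mul_one a := Subtype.ext (funext fun p => mul_one (a.1 p))
  mul_comm a b := Subtype.ext (funext fun p => mul_comm (a.1 p) (b.1 p))
  zero_mul a := Subtype.ext (funext fun p => zero_mul (a.1 p))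
  mul_zero a := Subtype.ext (funext fun p => mul_zero (a.1 p))

instance tildeSections.instAction (U : Opens (TopCat.of (MSpec A))) :
    MulActionWithZero (tildeSections A A U) (tildeSections A M U) where
  smul a s := ⟨fun p => a.1 p • s.1 p, isLocallyFraction_smul a.2 s.2⟩
  one_smul s := Subtype.ext (funext fun p => one_smul _ (s.1 p))
  mul_smul a b s := Subtype.ext (funext fun p => mul_smul (a.1 p) (b.1 p) (s.1 p))
  smul_zero a := Subtype.ext (funext fun p => smul_zero (a.1 p))
  zero_smul s := Subtype.ext (funext fun p => zero_smul _ (s.1 p))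

theorem isLocallyFraction_map {N : Type u} [Zero N] [MulActionWithZero A N] (φ : M →[A] N)
    {U : Opens (TopCat.of (MSpec A))} {s : ∀ p : U, localizationAt A M p.1}
    (hs : (isLocallyFraction A M).pred s) :
    (isLocallyFraction A N).pred fun p => OreLocalization.mapActionHom p.1.primeCompl φ (s p) := by
  intro p
  obtain ⟨V, hpV, i, m, f, hV⟩ := hs p
  refine ⟨V, hpV, i, φ m, f, fun q => ?_⟩
  obtain ⟨hf, e⟩ := hV q
  refine ⟨hf, ?_⟩
  have e' : s ⟨q.1, i.le q.2⟩ = m /ₒ ⟨f, hf⟩ := e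
  change OreLocalization.mapActionHom q.1.primeCompl φ (s ⟨q.1, i.le q.2⟩) = _
  rw [e']
  rfl

end Tilde

/-- The affine monoid scheme of a monoid: its spectrum with the structure sheaf. -/
def mSpec (A : Type u) [CommMonoidWithZero A] : MonoidalSpace.{u} where
  carrier := TopCat.of (MSpec A)
  sheaf := TopCat.subsheafToTypes (isLocallyFraction A A)
  monoid U := tildeSections.instMonoid (A := A) U
  res_zero _ := rfl
  res_one _ := rfl
  res_mul _ _ _ := rfl

/-- The sheaf of modules `M~` on the spectrum. -/
def tildeObj {A : Type u} [CommMonoidWithZero A] (M : AMod A) : OMod (mSpec A) where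
  sheaf := TopCat.subsheafToTypes (isLocallyFraction A M.carrier)
  zero U := tildeSections.instZero (A := A) (M := M.carrier) U
  action U := tildeSections.instAction (A := A) (M := M.carrier) U
  res_zero _ := rfl
  res_smul _ _ _ := rfl

/-! ## Monoid schemes, quasicoherent and coherent sheaves -/

/-- An open immersion `Y ⟶ X` of monoidal spaces: an open embedding with a map of sheaves of
monoids that is an isomorphism over the image. -/
structure OpenImmersion (Y X : MonoidalSpace.{u}) where
  map : Y.carrier ⟶ X.carrier
  isOpenEmbedding : Topology.IsOpenEmbedding map
  comap (V : Opens X.carrier) : X.Γ V →*₀ Y.Γ ((Opens.map map).obj V)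
  comap_res {V W : Opens X.carrier} (i : W ⟶ V) (a : X.Γ V) :
    comap W (X.res i a) = Y.res ((Opens.map map).map i) (comap V a)
  bijective (V : Opens X.carrier) : (V : Set X.carrier) ⊆ Set.range map →
    Function.Bijective (comap V)

/-- The data of an isomorphism between the restriction of `F` to the image of an open immersion
`j` and the sheaf of modules `G`. -/
structure OpenImmersion.RestrictionIso {Y X : MonoidalSpace.{u}} (j : OpenImmersion Y X)
    (F : OMod X) (G : OMod Y) where
  equiv (V : Opens X.carrier) (hV : (V : Set X.carrier) ⊆ Set.range j.map) :
    F.Γ V ≃ G.Γ ((Opens.map j.map).obj V)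
  map_zero (V : Opens X.carrier) (hV : (V : Set X.carrier) ⊆ Set.range j.map) : equiv V hV 0 = 0
  map_smul (V : Opens X.carrier) (hV : (V : Set X.carrier) ⊆ Set.range j.map) (a : X.Γ V)
    (s : F.Γ V) : equiv V hV (a • s) = j.comap V a • equiv V hV s
  equiv_res {V W : Opens X.carrier} (hV : (V : Set X.carrier) ⊆ Set.range j.map)
    (hW : (W : Set X.carrier) ⊆ Set.range j.map) (i : W ⟶ V) (s : F.Γ V) :
    equiv W hW (F.res i s) = G.res ((Opens.map j.map).map i) (equiv V hV s)

/-- An affine chart of a monoidal space: an open subspace that is identified with the spectrum of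
a monoid. -/
structure AffineChart (X : MonoidalSpace.{u}) where
  A : Type u
  [monoid : CommMonoidWithZero A]
  immersion : OpenImmersion (mSpec A) X

attribute [instance] AffineChart.monoid

/-- The open affine subset of a chart. -/
def AffineChart.range {X : MonoidalSpace.{u}} (c : AffineChart X) : Set X.carrier :=
  Set.range c.immersion.map

/-- Monoid schemes: every point has an open affine neighbourhood. -/
def MonoidalSpace.IsMonoidScheme (X : MonoidalSpace.{u}) : Prop :=
  ∀ x : X.carrier, ∃ c : AffineChart X, x ∈ c.range

/-- The space has a finite open covering by spectra of finitely generated monoids. -/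
def MonoidalSpace.IsFiniteType (X : MonoidalSpace.{u}) : Prop :=
  ∃ (n : ℕ) (c : Fin n → AffineChart X), (∀ k, Monoid.FG (c k).A) ∧
    ∀ x : X.carrier, ∃ k, x ∈ (c k).range

namespace OMod

/-- Quasicoherent sheaves. -/
def isQuasicoherent (X : MonoidalSpace.{u}) : ObjectProperty (OMod X) :=
  fun F => ∀ x : X.carrier, ∃ c : AffineChart X, x ∈ c.range ∧
    ∃ M : AMod c.A, Nonempty (c.immersion.RestrictionIso F (tildeObj M))

/-- Coherent sheaves. -/
def isCoherent (X : MonoidalSpace.{u}) : ObjectProperty (OMod X) :=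
  fun F => ∀ x : X.carrier, ∃ c : AffineChart X, x ∈ c.range ∧
    ∃ M : AMod c.A, AMod.isFG c.A M ∧ Nonempty (c.immersion.RestrictionIso F (tildeObj M))

/-- Sheaves with support in `Z`. -/
def isSupportedIn {X : MonoidalSpace.{u}} (Z : Set X.carrier) : ObjectProperty (OMod X) :=
  fun F => F.support ⊆ Z

/-- A sheaf of ideals, as a subobject of the structure sheaf. -/
structure IdealSheaf (X : MonoidalSpace.{u}) where
  toOMod : OMod X
  incl : toOMod ⟶ structureModule X
  injective (U : Opens X.carrier) : Function.Injective (app incl U)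

/-- The ideal of sections over `U`. -/
def IdealSheaf.ideal {X : MonoidalSpace.{u}} (I : IdealSheaf X) (U : Opens X.carrier) :
    Set (X.Γ U) :=
  Set.range (app I.incl U : I.toOMod.Γ U → X.Γ U)

/-- Sheaves `F` with `I · F = 0`. -/
def isAnnihilatedBy {X : MonoidalSpace.{u}} (I : IdealSheaf X) : ObjectProperty (OMod X) :=
  fun F => ∀ (U : Opens X.carrier), ∀ a ∈ I.ideal U, ∀ s : F.Γ U, a • s = 0

/-- The admissible monomorphisms in a full subcategory of sheaves of modules. -/
abbrev admMonoIn {X : MonoidalSpace.{u}} (P : ObjectProperty (OMod X)) :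
    MorphismProperty P.FullSubcategory :=
  (admMono X).inverseImage P.ι

/-- The admissible epimorphisms in a full subcategory of sheaves of modules. -/
abbrev admEpiIn {X : MonoidalSpace.{u}} (P : ObjectProperty (OMod X)) :
    MorphismProperty P.FullSubcategory :=
  (admEpi X).inverseImage P.ι

/-- The full subcategory of sheaves with the property `P`, with the admissible morphisms defined
on stalks, is proto-exact. -/
def IsProtoExactSubcategory {X : MonoidalSpace.{u}} (P : ObjectProperty (OMod X)) : Prop :=
  IsProtoExact (admMonoIn P) (admEpiIn P)

end OMod

/-! ## The functor `M ↦ M~` -/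

section TildeFunctor

variable (A : Type u) [CommMonoidWithZero A]

/-- The functor `M ↦ M~` to sheaves of modules. -/
def tilde : AMod A ⥤ OMod (mSpec A) where
  obj M := tildeObj M
  map {M N} φ :=
    { hom :=
        { app := fun U => TypeCat.ofHom
            fun s : tildeSections A M.carrier U.unop =>
              (⟨fun p => OreLocalization.mapActionHom p.1.primeCompl (AMod.Hom.toMap φ) (s.1 p),
                isLocallyFraction_map (AMod.Hom.toMap φ) s.2⟩ :
                tildeSections A N.carrier U.unop)
          naturality := fun _ _ _ => rfl }
      map_zero := fun U => Subtype.ext (funext fun p => by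
        change OreLocalization.mapActionHom p.1.primeCompl _ (0 : localizationAt A M.carrier p.1)
          = (0 : localizationAt A N.carrier p.1)
        rw [OreLocalization.zero_def, OreLocalization.zero_def]
        change AMod.Hom.toMap φ 0 /ₒ 1 = _
        rw [AMod.map_zero])
      map_smul := fun U a s => Subtype.ext (funext fun p => by
        obtain ⟨a, ha⟩ := a
        obtain ⟨s, hs⟩ := s
        change OreLocalization.mapActionHom p.1.primeCompl _ (a p • s p)
          = a p • OreLocalization.mapActionHom p.1.primeCompl _ (s p)
        generalize a p = b
        generalize s p = t
        induction b using OreLocalization.ind with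
        | _ b f =>
          induction t using OreLocalization.ind with
          | _ m g =>
            have h : (g : A) * b = b * g := mul_comm _ _
            rw [OreLocalization.oreDiv_smul_char b m f g b g h]
            change (AMod.Hom.toMap φ) (b • m) /ₒ (g * f) =
              (b /ₒ f) • ((AMod.Hom.toMap φ m) /ₒ g)
            rw [OreLocalization.oreDiv_smul_char b _ f g b g h, map_smul]) }
  map_id M := OMod.Hom.ext (NatTrans.ext (funext fun U => by
    ext s
    refine Subtype.ext (funext fun p => ?_)
    change OreLocalization.mapActionHom p.1.primeCompl (MulActionHom.id A) (s.1 p) = s.1 p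
    generalize s.1 p = t
    induction t using OreLocalization.ind with
    | _ m g => rfl))
  map_comp {M N L} φ ψ := OMod.Hom.ext (NatTrans.ext (funext fun U => by
    ext s
    refine Subtype.ext (funext fun p => ?_)
    change OreLocalization.mapActionHom p.1.primeCompl
        (MulActionHom.comp (AMod.Hom.toMap ψ) (AMod.Hom.toMap φ)) (s.1 p)
      = OreLocalization.mapActionHom p.1.primeCompl (AMod.Hom.toMap ψ)
          (OreLocalization.mapActionHom p.1.primeCompl (AMod.Hom.toMap φ) (s.1 p))
    generalize s.1 p = t
    induction t using OreLocalization.ind with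
    | _ m g => rfl))

/-- The identity of a monoidal space as an open immersion. -/
def OpenImmersion.id (X : MonoidalSpace.{u}) : OpenImmersion X X where
  map := 𝟙 _
  isOpenEmbedding := Topology.IsOpenEmbedding.id
  comap V := MonoidWithZeroHom.id (X.Γ V)
  comap_res _ _ := rfl
  bijective _ _ := Function.bijective_id

/-- The spectrum of a monoid as an affine chart of itself. -/
def AffineChart.self : AffineChart (mSpec A) where
  A := A
  immersion := OpenImmersion.id (mSpec A)

theorem AffineChart.mem_range_self (x : (mSpec A).carrier) : x ∈ (AffineChart.self A).range :=
  ⟨x, rfl⟩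

variable {A}

/-- Every sheaf of modules is isomorphic to its restriction to the whole space. -/
def OpenImmersion.RestrictionIso.refl {X : MonoidalSpace.{u}} (F : OMod X) :
    (OpenImmersion.id X).RestrictionIso F F where
  equiv V _ := Equiv.refl (F.Γ V)
  map_zero _ _ := rfl
  map_smul _ _ _ _ := rfl
  equiv_res _ _ _ _ := rfl

theorem tilde_isQuasicoherent (M : AMod A) : OMod.isQuasicoherent (mSpec A) ((tilde A).obj M) :=
  fun x => ⟨AffineChart.self A, AffineChart.mem_range_self A x, M,
    ⟨OpenImmersion.RestrictionIso.refl (tildeObj M)⟩⟩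

theorem tilde_isCoherent (M : AMod A) (hM : AMod.isFG A M) :
    OMod.isCoherent (mSpec A) ((tilde A).obj M) :=
  fun x => ⟨AffineChart.self A, AffineChart.mem_range_self A x, M, hM,
    ⟨OpenImmersion.RestrictionIso.refl (tildeObj M)⟩⟩

variable (A)

/-- The functor `M ↦ M~` from modules to quasicoherent sheaves. -/
def tildeQcoh : AMod A ⥤ (OMod.isQuasicoherent (mSpec A)).FullSubcategory :=
  (OMod.isQuasicoherent (mSpec A)).lift (tilde A) tilde_isQuasicoherent

/-- The functor `M ↦ M~` from finitely generated modules to coherent sheaves. -/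
def tildeCoh : (AMod.isFG A).FullSubcategory ⥤ (OMod.isCoherent (mSpec A)).FullSubcategory :=
  (OMod.isCoherent (mSpec A)).lift ((AMod.isFG A).ι ⋙ tilde A)
    fun M => tilde_isCoherent M.obj M.property

/-- The admissible monomorphisms of finitely generated modules. -/
abbrev AMod.admMonoFG : MorphismProperty (AMod.isFG A).FullSubcategory :=
  (AMod.admMono A).inverseImage (AMod.isFG A).ι

/-- The admissible epimorphisms of finitely generated modules. -/
abbrev AMod.admEpiFG : MorphismProperty (AMod.isFG A).FullSubcategory :=
  (AMod.admEpi A).inverseImage (AMod.isFG A).ι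

end TildeFunctor

end

noncomputable section

/-! ## Proto-exact structures induced along fully faithful functors -/

section Induced

variable {C : Type u₁} [Category.{v₁} C] {D : Type u₂} [Category.{v₂} D]

/-- The essential image of a functor `F` contains the zero objects and is closed under the
completions of admissible diagrams to biCartesian squares. -/
structure IsAdmissiblyClosed (M E : MorphismProperty C) (F : D ⥤ C) : Prop where
  zero : ∀ O : C, IsZero O → F.essImage O
  pullback : ∀ (A : C) (B A' B' : D) (i : A ⟶ F.obj B) (j : A ⟶ F.obj A')
    (j' : F.obj B ⟶ F.obj B') (i' : F.obj A' ⟶ F.obj B'), M i → M i' → E j → E j' →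
    IsPullback i j j' i' → IsPushout i j j' i' → F.essImage A
  pushout : ∀ (A B A' : D) (B' : C) (i : F.obj A ⟶ F.obj B) (j : F.obj A ⟶ F.obj A')
    (j' : F.obj B ⟶ B') (i' : F.obj A' ⟶ B'), M i → M i' → E j → E j' →
    IsPullback i j j' i' → IsPushout i j j' i' → F.essImage B'

theorem IsAdmissiblyClosed.of_isEquivalence (M E : MorphismProperty C) (F : D ⥤ C)
    [F.IsEquivalence] : IsAdmissiblyClosed M E F where
  zero O _ := Functor.EssSurj.mem_essImage (F := F) O
  pullback A _ _ _ _ _ _ _ _ _ _ _ _ _ := Functor.EssSurj.mem_essImage (F := F) A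
  pushout _ _ _ B' _ _ _ _ _ _ _ _ _ _ := Functor.EssSurj.mem_essImage (F := F) B'

theorem isZero_of_isZero_map (F : D ⥤ C) [F.Full] [F.Faithful] {X : D} (h : IsZero (F.obj X)) :
    IsZero X where
  unique_to _ := ⟨⟨⟨F.preimage (h.to_ _)⟩, fun _ => F.map_injective (h.eq_of_src _ _)⟩⟩
  unique_from _ := ⟨⟨⟨F.preimage (h.from_ _)⟩, fun _ => F.map_injective (h.eq_of_tgt _ _)⟩⟩

namespace IsProtoExact

variable {M E : MorphismProperty C} {F : D ⥤ C}

theorem mono_iso_comp (h : IsProtoExact M E) {X Y Z : C} (e : X ≅ Y) {f : Y ⟶ Z} (hf : M f) :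
    M (e.hom ≫ f) := h.mono_comp _ _ (h.mono_of_isIso _ inferInstance) hf

theorem mono_comp_iso (h : IsProtoExact M E) {X Y Z : C} {f : X ⟶ Y} (e : Y ≅ Z) (hf : M f) :
    M (f ≫ e.hom) := h.mono_comp _ _ hf (h.mono_of_isIso _ inferInstance)

theorem epi_iso_comp (h : IsProtoExact M E) {X Y Z : C} (e : X ≅ Y) {f : Y ⟶ Z} (hf : E f) :
    E (e.hom ≫ f) := h.epi_comp _ _ (h.epi_of_isIso _ inferInstance) hf

theorem epi_comp_iso (h : IsProtoExact M E) {X Y Z : C} {f : X ⟶ Y} (e : Y ≅ Z) (hf : E f) :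
    E (f ≫ e.hom) := h.epi_comp _ _ hf (h.epi_of_isIso _ inferInstance)

variable [F.Full]

theorem exists_pullback_of_closed (h : IsProtoExact M E) (hF : IsAdmissiblyClosed M E F)
    {B A' B' : D} (j' : B ⟶ B') (i' : A' ⟶ B') (hi' : M (F.map i')) (hj' : E (F.map j')) :
    ∃ (A : D) (i : A ⟶ B) (j : A ⟶ A'), M (F.map i) ∧ E (F.map j) ∧
      IsPullback (F.map i) (F.map j) (F.map j') (F.map i') ∧
      IsPushout (F.map i) (F.map j) (F.map j') (F.map i') := by
  obtain ⟨A, i, j, hi, hj, h₁, h₂⟩ := h.exists_pullback _ _ hi' hj'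
  obtain ⟨A₀, ⟨e⟩⟩ := hF.pullback A B A' B' i j _ _ hi hi' hj hj' h₁ h₂
  refine ⟨A₀, F.preimage (e.hom ≫ i), F.preimage (e.hom ≫ j), ?_, ?_, ?_, ?_⟩ <;>
    simp only [F.map_preimage]
  · exact h.mono_iso_comp e hi
  · exact h.epi_iso_comp e hj
  · exact h₁.of_iso e.symm (Iso.refl _) (Iso.refl _) (Iso.refl _) (by simp) (by simp) (by simp)
      (by simp)
  · exact h₂.of_iso e.symm (Iso.refl _) (Iso.refl _) (Iso.refl _) (by simp) (by simp) (by simp)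
      (by simp)

theorem exists_pushout_of_closed (h : IsProtoExact M E) (hF : IsAdmissiblyClosed M E F)
    {A B A' : D} (i : A ⟶ B) (j : A ⟶ A') (hi : M (F.map i)) (hj : E (F.map j)) :
    ∃ (B' : D) (j' : B ⟶ B') (i' : A' ⟶ B'), M (F.map i') ∧ E (F.map j') ∧
      IsPullback (F.map i) (F.map j) (F.map j') (F.map i') ∧
      IsPushout (F.map i) (F.map j) (F.map j') (F.map i') := by
  obtain ⟨B', j', i', hi', hj', h₁, h₂⟩ := h.exists_pushout _ _ hi hj
  obtain ⟨B₀, ⟨e⟩⟩ := hF.pushout A B A' B' _ _ j' i' hi hi' hj hj' h₁ h₂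
  refine ⟨B₀, F.preimage (j' ≫ e.inv), F.preimage (i' ≫ e.inv), ?_, ?_, ?_, ?_⟩ <;>
    simp only [F.map_preimage]
  · exact h.mono_comp_iso e.symm hi'
  · exact h.epi_comp_iso e.symm hj'
  · exact h₁.of_iso (Iso.refl _) (Iso.refl _) (Iso.refl _) e.symm (by simp) (by simp) (by simp)
      (by simp)
  · exact h₂.of_iso (Iso.refl _) (Iso.refl _) (Iso.refl _) e.symm (by simp) (by simp) (by simp)
      (by simp)

variable [F.Faithful]

/-- Cartesian admissible squares stay Cartesian under `F`. -/
theorem map_isPullback (h : IsProtoExact M E) (hF : IsAdmissiblyClosed M E F)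
    {A B A' B' : D} {i : A ⟶ B} {j : A ⟶ A'} {j' : B ⟶ B'} {i' : A' ⟶ B'}
    (hi' : M (F.map i')) (hj' : E (F.map j')) (hp : IsPullback i j j' i') :
    IsPullback (F.map i) (F.map j) (F.map j') (F.map i') := by
  obtain ⟨A₀, i₀, j₀, -, -, h₁, -⟩ := h.exists_pullback_of_closed hF j' i' hi' hj'
  have h₀ : IsPullback i₀ j₀ j' i' := IsPullback.of_map F
    (F.map_injective (by simpa using h₁.w)) h₁
  refine h₁.of_iso (F.mapIso (h₀.isoIsPullback _ _ hp)) (Iso.refl _) (Iso.refl _) (Iso.refl _)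
    ?_ ?_ (by simp) (by simp) <;> simp [← F.map_comp]

/-- CoCartesian admissible squares stay coCartesian under `F`. -/
theorem map_isPushout (h : IsProtoExact M E) (hF : IsAdmissiblyClosed M E F)
    {A B A' B' : D} {i : A ⟶ B} {j : A ⟶ A'} {j' : B ⟶ B'} {i' : A' ⟶ B'}
    (hi : M (F.map i)) (hj : E (F.map j)) (hp : IsPushout i j j' i') :
    IsPushout (F.map i) (F.map j) (F.map j') (F.map i') := by
  obtain ⟨B₀, j₀, i₀, -, -, -, h₁⟩ := h.exists_pushout_of_closed hF i j hi hj
  have h₀ : IsPushout i j j₀ i₀ := IsPushout.of_map F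
    (F.map_injective (by simpa using h₁.w)) h₁
  refine h₁.of_iso (Iso.refl _) (Iso.refl _) (Iso.refl _) (F.mapIso (h₀.isoIsPushout _ _ hp))
    (by simp) (by simp) ?_ ?_ <;> simp [← F.map_comp]

theorem map_isZero (h : IsProtoExact M E) (hF : IsAdmissiblyClosed M E F) {X : D}
    (hX : IsZero X) : IsZero (F.obj X) := by
  obtain ⟨O, hO⟩ := h.hasZeroObject.zero
  obtain ⟨Y, ⟨e⟩⟩ := hF.zero O hO
  have hY : IsZero (F.obj Y) := hO.of_iso e
  exact hY.of_iso (F.mapIso (hX.iso (isZero_of_isZero_map F hY)))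

/-- A proto-exact structure restricts along a fully faithful functor with admissibly closed
essential image. -/
theorem inverseImage (h : IsProtoExact M E) (hF : IsAdmissiblyClosed M E F) :
    IsProtoExact (M.inverseImage F) (E.inverseImage F) where
  hasZeroObject := by
    obtain ⟨O, hO⟩ := h.hasZeroObject.zero
    obtain ⟨Y, ⟨e⟩⟩ := hF.zero O hO
    exact ⟨⟨Y, isZero_of_isZero_map F (hO.of_iso e)⟩⟩
  mono_of_isZero _ _ f hO := h.mono_of_isZero (F.map f) (h.map_isZero hF hO)
  epi_of_isZero _ _ f hO := h.epi_of_isZero (F.map f) (h.map_isZero hF hO)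
  mono_comp _ _ _ f g hf hg := by
    change M (F.map (f ≫ g))
    rw [F.map_comp]
    exact h.mono_comp _ _ hf hg
  epi_comp _ _ _ f g hf hg := by
    change E (F.map (f ≫ g))
    rw [F.map_comp]
    exact h.epi_comp _ _ hf hg
  mono_of_isIso _ _ f _ := h.mono_of_isIso (F.map f) inferInstance
  epi_of_isIso _ _ f _ := h.epi_of_isIso (F.map f) inferInstance
  cartesian_iff_cocartesian A B A' B' i j j' i' sq hi hi' hj hj' :=
    have key := h.cartesian_iff_cocartesian _ _ _ _ (sq.map F) hi hi' hj hj'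
    ⟨fun hp => IsPushout.of_map F sq.w (key.1 (h.map_isPullback hF hi' hj' hp)),
      fun hp => IsPullback.of_map F sq.w (key.2 (h.map_isPushout hF hi hj hp))⟩
  exists_pushout A B A' i j hi hj := by
    obtain ⟨B', j', i', hi', hj', h₁, h₂⟩ := h.exists_pushout_of_closed hF i j hi hj
    have w : i ≫ j' = j ≫ i' := F.map_injective (by simpa using h₁.w)
    exact ⟨B', j', i', hi', hj', IsPullback.of_map F w h₁, IsPushout.of_map F w h₂⟩
  exists_pullback B A' B' j' i' hi' hj' := by
    obtain ⟨A, i, j, hi, hj, h₁, h₂⟩ := h.exists_pullback_of_closed hF j' i' hi' hj'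
    have w : i ≫ j' = j ≫ i' := F.map_injective (by simpa using h₁.w)
    exact ⟨A, i, j, hi, hj, IsPullback.of_map F w h₁, IsPushout.of_map F w h₂⟩

theorem isExactFunctor (h : IsProtoExact M E) (hF : IsAdmissiblyClosed M E F) :
    IsExactFunctor (M.inverseImage F) (E.inverseImage F) M E F :=
  fun _ _ _ _ _ _ _ _ hs =>
    { isZero := h.map_isZero hF hs.isZero
      mono_top := hs.mono_top
      mono_bot := hs.mono_bot
      epi_left := hs.epi_left
      epi_right := hs.epi_right
      isPullback := h.map_isPullback hF hs.mono_bot hs.epi_right hs.isPullback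
      isPushout := h.map_isPushout hF hs.mono_top hs.epi_left hs.isPushout }

end IsProtoExact

/-- Fully faithful functors reflect the induced admissible short exact sequences. -/
theorem IsAdmissibleShortExact.of_map {M E : MorphismProperty C} (F : D ⥤ C) [F.Full]
    [F.Faithful] {A B O Q : D} {i : A ⟶ B} {j : A ⟶ O} {j' : B ⟶ Q} {i' : O ⟶ Q}
    (hs : IsAdmissibleShortExact M E (F.map i) (F.map j) (F.map j') (F.map i')) :
    IsAdmissibleShortExact (M.inverseImage F) (E.inverseImage F) i j j' i' :=
  have w : i ≫ j' = j ≫ i' := F.map_injective (by simpa using hs.isPullback.w)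
  { isZero := isZero_of_isZero_map F hs.isZero
    mono_top := hs.mono_top
    mono_bot := hs.mono_bot
    epi_left := hs.epi_left
    epi_right := hs.epi_right
    isPullback := IsPullback.of_map F w hs.isPullback
    isPushout := IsPushout.of_map F w hs.isPushout }

theorem IsProtoExact.isExactEquivalence {M E : MorphismProperty C} {F : D ⥤ C}
    (h : IsProtoExact M E) (hF : F.IsEquivalence) :
    IsExactEquivalence (M.inverseImage F) (E.inverseImage F) M E F where
  isEquivalence := hF
  isExact := h.isExactFunctor (.of_isEquivalence M E F)
  reflects _ _ _ _ _ _ _ _ hs := hs.of_map F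

/-- The inclusion of a smaller full subcategory into a bigger one is exact. -/
theorem IsProtoExact.isExactFunctor_ιOfLE {M E : MorphismProperty C} (h : IsProtoExact M E)
    {P Q : ObjectProperty C} (hPQ : P ≤ Q) (hP : IsAdmissiblyClosed M E P.ι) :
    IsExactFunctor (M.inverseImage P.ι) (E.inverseImage P.ι) (M.inverseImage Q.ι)
      (E.inverseImage Q.ι) (ObjectProperty.ιOfLE hPQ) :=
  fun _ _ _ _ _ _ _ _ hs => IsAdmissibleShortExact.of_map Q.ι (h.isExactFunctor hP _ _ _ _ hs)

end Induced

/-! ## Modules over a diagram of monoids -/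

/-- A contravariant diagram of monoids on a preordered set. -/
structure MonoidDiagram (P : Type u) [Preorder P] where
  obj : P → Type u
  [monoid : ∀ x, CommMonoidWithZero (obj x)]
  res {x y : P} (h : y ≤ x) : obj x → obj y

attribute [instance] MonoidDiagram.monoid

section DiagramModules

variable {P : Type u} [Preorder P]

/-- A module over a diagram of monoids. -/
structure DMod (D : MonoidDiagram P) where
  obj : P → Type u
  [zero : ∀ x, Zero (obj x)]
  [action : ∀ x, MulActionWithZero (D.obj x) (obj x)]
  res {x y : P} (h : y ≤ x) : obj x → obj y
  res_zero {x y : P} (h : y ≤ x) : res h 0 = 0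
  res_smul {x y : P} (h : y ≤ x) (a : D.obj x) (s : obj x) :
    res h (a • s) = D.res h a • res h s
  res_refl (x : P) (s : obj x) : res (le_refl x) s = s
  res_trans {x y z : P} (h : y ≤ x) (h' : z ≤ y) (s : obj x) :
    res h' (res h s) = res (h'.trans h) s

attribute [instance] DMod.zero DMod.action

namespace DMod

variable {D : MonoidDiagram P}

/-- Morphisms of modules over a diagram of monoids. -/
@[ext]
structure Hom (M N : DMod D) where
  app (x : P) : M.obj x → N.obj x
  map_smul (x : P) (a : D.obj x) (s : M.obj x) : app x (a • s) = a • app x s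
  naturality {x y : P} (h : y ≤ x) (s : M.obj x) : app y (M.res h s) = N.res h (app x s)

instance : Category (DMod D) where
  Hom M N := Hom M N
  id M := { app := fun _ s => s, map_smul := fun _ _ _ => rfl, naturality := fun _ _ => rfl }
  comp f g :=
    { app := fun x s => g.app x (f.app x s)
      map_smul := fun x a s => by rw [f.map_smul, g.map_smul]
      naturality := fun h s => by rw [f.naturality, g.naturality] }

/-- The component of a morphism. -/
def app {M N : DMod D} (f : M ⟶ N) (x : P) : M.obj x → N.obj x := Hom.app f x

theorem hom_ext {M N : DMod D} {f g : M ⟶ N} (h : ∀ x s, app f x s = app g x s) : f = g :=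
  Hom.ext (funext fun x => funext fun s => h x s)

@[simp]
theorem comp_app {M N L : DMod D} (f : M ⟶ N) (g : N ⟶ L) (x : P) (s : M.obj x) :
    app (f ≫ g) x s = app g x (app f x s) := rfl

@[simp]
theorem id_app (M : DMod D) (x : P) (s : M.obj x) : app (𝟙 M) x s = s := rfl

theorem app_smul {M N : DMod D} (f : M ⟶ N) (x : P) (a : D.obj x) (s : M.obj x) :
    app f x (a • s) = a • app f x s := Hom.map_smul f x a s

theorem app_res {M N : DMod D} (f : M ⟶ N) {x y : P} (h : y ≤ x) (s : M.obj x) :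
    app f y (M.res h s) = N.res h (app f x s) := Hom.naturality f h s

@[simp]
theorem app_zero {M N : DMod D} (f : M ⟶ N) (x : P) : app f x 0 = 0 := by
  rw [← zero_smul (D.obj x) (0 : M.obj x), app_smul, zero_smul]

/-- The zero morphism. -/
def zeroHom (M N : DMod D) : M ⟶ N :=
  Hom.mk (fun _ _ => 0) (fun _ a _ => (smul_zero a).symm) fun h _ => (N.res_zero h).symm

theorem eq_zero_of_isZero {M : DMod D} (h : IsZero M) {x : P} (s : M.obj x) : s = 0 :=
  congrArg (fun f : M ⟶ M => app f x s) (h.eq_of_src (𝟙 M) (zeroHom M M))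

theorem isZero_of_forall_eq_zero {M : DMod D} (h : ∀ x (s : M.obj x), s = 0) : IsZero M where
  unique_to N := ⟨⟨⟨zeroHom M N⟩, fun f => hom_ext fun x s => by
    rw [h x s, app_zero, app_zero]⟩⟩
  unique_from N := ⟨⟨⟨zeroHom N M⟩, fun _ => hom_ext fun x _ =>
    (h x _).trans (h x _).symm⟩⟩

/-- The zero module. -/
def zeroObj (D : MonoidDiagram P) : DMod D where
  obj _ := PUnit
  zero _ := ⟨PUnit.unit⟩
  action _ :=
    { smul := fun _ _ => PUnit.unit
      one_smul := fun _ => rfl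
      mul_smul := fun _ _ _ => rfl
      smul_zero := fun _ => rfl
      zero_smul := fun _ => rfl }
  res _ _ := PUnit.unit
  res_zero _ := rfl
  res_smul _ _ _ := rfl
  res_refl _ _ := rfl
  res_trans _ _ _ := rfl

/-- Admissible monomorphisms: the injective morphisms. -/
def admMono (D : MonoidDiagram P) : MorphismProperty (DMod D) :=
  fun _ _ f => ∀ x, Function.Injective (app f x)

/-- Admissible epimorphisms. -/
def admEpi (D : MonoidDiagram P) : MorphismProperty (DMod D) :=
  fun _ _ f => ∀ x, IsAdmissibleSurjection (app f x)

theorem bijective_of_isIso {M N : DMod D} (f : M ⟶ N) [IsIso f] (x : P) :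
    Function.Bijective (app f x) := by
  refine Function.bijective_iff_has_inverse.2 ⟨app (inv f) x, fun s => ?_, fun s => ?_⟩
  · rw [← comp_app, IsIso.hom_inv_id, id_app]
  · rw [← comp_app, IsIso.inv_hom_id, id_app]

/-- A bijective morphism is an isomorphism. -/
def isoOfBijective {M N : DMod D} (f : M ⟶ N) (h : ∀ x, Function.Bijective (app f x)) :
    M ≅ N where
  hom := f
  inv := Hom.mk (fun x => (Equiv.ofBijective _ (h x)).symm)
    (fun x a s => by
      rw [Equiv.symm_apply_eq]
      change _ = app f x _
      rw [app_smul]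
      congr 1
      exact ((Equiv.ofBijective _ (h x)).apply_symm_apply s).symm)
    (fun {x y} hy s => by
      rw [Equiv.symm_apply_eq]
      change _ = app f y _
      rw [app_res]
      congr 1
      exact ((Equiv.ofBijective _ (h x)).apply_symm_apply s).symm)
  hom_inv_id := hom_ext fun x s => (Equiv.ofBijective _ (h x)).symm_apply_apply s
  inv_hom_id := hom_ext fun x s => (Equiv.ofBijective _ (h x)).apply_symm_apply s

/-! ### Submodules and quotients -/

/-- A family of subsets that is stable under the action and the restrictions. -/
structure IsSubmodule (M : DMod D) (S : ∀ x, Set (M.obj x)) : Prop where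
  zero_mem (x : P) : 0 ∈ S x
  smul_mem {x : P} (a : D.obj x) {s : M.obj x} : s ∈ S x → a • s ∈ S x
  res_mem {x y : P} (h : y ≤ x) {s : M.obj x} : s ∈ S x → M.res h s ∈ S y

/-- A submodule as a module. -/
def sub {M : DMod D} {S : ∀ x, Set (M.obj x)} (hS : IsSubmodule M S) : DMod D where
  obj x := S x
  zero x := ⟨⟨0, hS.zero_mem x⟩⟩
  action x :=
    letI : Zero (S x) := ⟨⟨0, hS.zero_mem x⟩⟩
    { smul := fun a s => ⟨a • s.1, hS.smul_mem a s.2⟩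
      one_smul := fun s => Subtype.ext (one_smul _ s.1)
      mul_smul := fun a b s => Subtype.ext (mul_smul a b s.1)
      smul_zero := fun a => Subtype.ext (smul_zero a)
      zero_smul := fun s => Subtype.ext (zero_smul _ s.1) }
  res h s := ⟨M.res h s.1, hS.res_mem h s.2⟩
  res_zero h := Subtype.ext (M.res_zero h)
  res_smul h a s := Subtype.ext (M.res_smul h a s.1)
  res_refl x s := Subtype.ext (M.res_refl x s.1)
  res_trans h h' s := Subtype.ext (M.res_trans h h' s.1)

/-- The inclusion of a submodule. -/
def subι {M : DMod D} {S : ∀ x, Set (M.obj x)} (hS : IsSubmodule M S) : sub hS ⟶ M :=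
  Hom.mk (fun _ s => s.1) (fun _ _ _ => rfl) fun _ _ => rfl

/-- The relation that collapses a submodule to the base point. -/
def collapse {M : DMod D} {S : ∀ x, Set (M.obj x)} (x : P) : Setoid (M.obj x) where
  r s t := s = t ∨ (s ∈ S x ∧ t ∈ S x)
  iseqv :=
    { refl := fun _ => Or.inl rfl
      symm := by
        rintro s t (rfl | ⟨h, h'⟩)
        · exact Or.inl rfl
        · exact Or.inr ⟨h', h⟩
      trans := by
        rintro s t r (rfl | ⟨h, h'⟩) (rfl | ⟨k, k'⟩)
        · exact Or.inl rfl
        · exact Or.inr ⟨k, k'⟩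
        · exact Or.inr ⟨h, h'⟩
        · exact Or.inr ⟨h, k'⟩ }

/-- The quotient by a submodule. -/
def quot {M : DMod D} {S : ∀ x, Set (M.obj x)} (hS : IsSubmodule M S) : DMod D where
  obj x := Quotient (collapse (S := S) x)
  zero x := ⟨Quotient.mk _ 0⟩
  action x :=
    letI : Zero (Quotient (collapse (S := S) x)) := ⟨Quotient.mk _ 0⟩
    { smul := fun a => Quotient.map (a • ·) (by
        rintro s t (rfl | ⟨h, h'⟩)
        · exact Or.inl rfl
        · exact Or.inr ⟨hS.smul_mem a h, hS.smul_mem a h'⟩)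
      one_smul := by
        rintro ⟨s⟩
        exact congrArg _ (one_smul _ s)
      mul_smul := by
        rintro a b ⟨s⟩
        exact congrArg _ (mul_smul a b s)
      smul_zero := fun a => congrArg _ (smul_zero a)
      zero_smul := by
        rintro ⟨s⟩
        exact congrArg _ (zero_smul _ s) }
  res {x y} h := Quotient.map (M.res h) (by
    rintro s t (rfl | ⟨k, k'⟩)
    · exact Or.inl rfl
    · exact Or.inr ⟨hS.res_mem h k, hS.res_mem h k'⟩)
  res_zero h := congrArg _ (M.res_zero h)
  res_smul h a := by
    rintro ⟨s⟩
    exact congrArg _ (M.res_smul h a s)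
  res_refl x := by
    rintro ⟨s⟩
    exact congrArg _ (M.res_refl x s)
  res_trans h h' := by
    rintro ⟨s⟩
    exact congrArg _ (M.res_trans h h' s)

/-- The projection to the quotient. -/
def quotπ {M : DMod D} {S : ∀ x, Set (M.obj x)} (hS : IsSubmodule M S) : M ⟶ quot hS :=
  Hom.mk (fun _ s => Quotient.mk _ s) (fun _ _ _ => rfl) fun _ _ => rfl

theorem quotπ_eq_iff {M : DMod D} {S : ∀ x, Set (M.obj x)} (hS : IsSubmodule M S) {x : P}
    {s t : M.obj x} : app (quotπ hS) x s = app (quotπ hS) x t ↔ s = t ∨ (s ∈ S x ∧ t ∈ S x) :=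
  Quotient.eq (r := collapse x)

theorem quotπ_eq_zero_iff {M : DMod D} {S : ∀ x, Set (M.obj x)} (hS : IsSubmodule M S) {x : P}
    {s : M.obj x} : app (quotπ hS) x s = 0 ↔ s ∈ S x := by
  rw [← app_zero (quotπ hS), quotπ_eq_iff]
  refine ⟨?_, fun h => Or.inr ⟨h, hS.zero_mem x⟩⟩
  rintro (rfl | h)
  · exact hS.zero_mem x
  · exact h.1

theorem quotπ_mem_admEpi {M : DMod D} {S : ∀ x, Set (M.obj x)} (hS : IsSubmodule M S) :
    admEpi D (quotπ hS) := by
  refine fun x => ⟨fun q => ?_, fun s hs t _ hst => ?_⟩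
  · obtain ⟨s, rfl⟩ := Quotient.exists_rep q
    exact ⟨s, rfl⟩
  · rcases (quotπ_eq_iff hS).1 hst with h | h
    · exact h
    · exact absurd ((quotπ_eq_zero_iff hS).2 h.1) hs

/-! ### Admissible squares -/

section Squares

variable {A B A' B' : DMod D} {i : A ⟶ B} {j : A ⟶ A'} {j' : B ⟶ B'} {i' : A' ⟶ B'}

/-- Pointwise form of the condition that an admissible square is biCartesian. -/
def ContainsPreimage (i : A ⟶ B) (j' : B ⟶ B') (i' : A' ⟶ B') : Prop :=
  ∀ x (b : B.obj x) (a' : A'.obj x), app j' x b = app i' x a' → ∃ a, app i x a = b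

theorem isPullback_of_containsPreimage (w : i ≫ j' = j ≫ i') (hi : admMono D i)
    (hi' : admMono D i') (h : ContainsPreimage i j' i') : IsPullback i j j' i' := by
  have wx (x a) : app j' x (app i x a) = app i' x (app j x a) :=
    congrArg (fun f => app f x a) w
  refine ⟨⟨w⟩, ⟨PullbackCone.IsLimit.mk w (fun s => ?_) (fun s => ?_) (fun s => ?_) ?_⟩⟩
  · have hs (x t) : app i x (h x (app s.fst x t) (app s.snd x t)
        (congrArg (fun f => app f x t) s.condition)).choose = app s.fst x t :=
      (h x (app s.fst x t) (app s.snd x t)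
        (congrArg (fun f => app f x t) s.condition)).choose_spec
    refine Hom.mk (fun x t => (h x (app s.fst x t) (app s.snd x t)
      (congrArg (fun f => app f x t) s.condition)).choose) (fun x a t => hi x ?_)
      fun {x y} hxy t => hi y ?_
    · rw [hs, app_smul, app_smul, hs]
    · rw [hs, app_res, app_res, hs]
  · exact hom_ext fun x t => (h x (app s.fst x t) (app s.snd x t)
        (congrArg (fun f => app f x t) s.condition)).choose_spec
  · refine hom_ext fun x t => hi' x ?_
    rw [comp_app, ← wx]
    exact (congrArg (app j' x) (h x (app s.fst x t) (app s.snd x t)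
        (congrArg (fun f => app f x t) s.condition)).choose_spec).trans
      (congrArg (fun f => app f x t) s.condition)
  · intro s m hm _
    refine hom_ext fun x t => hi x ((congrArg (fun f => app f x t) hm).trans ?_)
    exact (h x (app s.fst x t) (app s.snd x t)
      (congrArg (fun f => app f x t) s.condition)).choose_spec.symm

/-- The kernel of an admissible epimorphism. -/
theorem eq_or_eq_zero {f : A ⟶ B} (hf : admEpi D f) {x : P} {s t : A.obj x}
    (h : app f x s = app f x t) : s = t ∨ (app f x s = 0 ∧ app f x t = 0) := by
  by_cases hs : app f x s = 0
  · exact Or.inr ⟨hs, h ▸ hs⟩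
  · exact Or.inl ((hf x).2 hs (fun h0 => hs (h.trans h0)) h)

theorem isPushout_of_containsPreimage (w : i ≫ j' = j ≫ i') (hj : admEpi D j)
    (hi' : admMono D i') (hj' : admEpi D j')
    (h : ContainsPreimage i j' i') : IsPushout i j j' i' := by
  have wx (x a) : app j' x (app i x a) = app i' x (app j x a) :=
    congrArg (fun f => app f x a) w
  have key (s : PushoutCocone i j) {x : P} {b c : B.obj x} (hbc : app j' x b = app j' x c) :
      app s.inl x b = app s.inl x c := by
    have hz {b : B.obj x} (hb : app j' x b = 0) : app s.inl x b = 0 := by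
      obtain ⟨a, rfl⟩ := h x b 0 (by rw [hb, app_zero])
      have ha : app j x a = 0 := hi' x (by rw [← wx, hb, app_zero])
      refine (congrArg (fun f => app f x a) s.condition).trans ?_
      rw [comp_app, ha, app_zero]
    rcases eq_or_eq_zero hj' hbc with rfl | ⟨hb, hc⟩
    · rfl
    · rw [hz hb, hz hc]
  choose g hg using fun x => (hj' x).1
  refine ⟨⟨w⟩, ⟨PushoutCocone.IsColimit.mk w (fun s => Hom.mk (fun x t => app s.inl x (g x t))
    (fun x a t => ?_) (fun {x y} hxy t => ?_)) (fun s => ?_) (fun s => ?_) ?_⟩⟩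
  · rw [← app_smul]
    exact key s (by rw [hg, app_smul, hg])
  · rw [← app_res]
    exact key s (by rw [hg, app_res, hg])
  · exact hom_ext fun x t => key s (hg x _)
  · refine hom_ext fun x t => ?_
    obtain ⟨a, rfl⟩ := (hj x).1 t
    refine (key s (c := app i x a) ?_).trans (congrArg (fun f => app f x a) s.condition)
    exact (hg x _).trans (wx x a).symm
  · intro s m hm _
    refine hom_ext fun x t => ?_
    refine (congrArg (app m x) (hg x t)).symm.trans (congrArg (fun f => app f x (g x t)) hm)

/-- The preimage of a submodule. -/
theorem isSubmodule_preimage (j' : B ⟶ B') (i' : A' ⟶ B') :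
    IsSubmodule B fun x => {b | ∃ a', app i' x a' = app j' x b} where
  zero_mem x := ⟨0, by simp⟩
  smul_mem := by
    rintro x a s ⟨t, ht⟩
    exact ⟨a • t, by rw [app_smul, app_smul, ht]⟩
  res_mem := by
    rintro x y h s ⟨t, ht⟩
    exact ⟨A'.res h t, by rw [app_res, app_res, ht]⟩

/-- The image of the kernel of `j` under `i`. -/
theorem isSubmodule_image_ker (i : A ⟶ B) (j : A ⟶ A') :
    IsSubmodule B fun x => {b | ∃ a, app j x a = 0 ∧ app i x a = b} where
  zero_mem x := ⟨0, by simp⟩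
  smul_mem := by
    rintro x a s ⟨t, ht, rfl⟩
    exact ⟨a • t, by rw [app_smul, ht, smul_zero], by rw [app_smul]⟩
  res_mem := by
    rintro x y h s ⟨t, ht, rfl⟩
    exact ⟨A.res h t, by rw [app_res, ht, A'.res_zero], by rw [app_res]⟩

theorem exists_admissible_pullback (hi' : admMono D i') (hj' : admEpi D j') :
    ∃ (A : DMod D) (i : A ⟶ B) (j : A ⟶ A'), admMono D i ∧ admEpi D j ∧ i ≫ j' = j ≫ i' ∧
      ContainsPreimage i j' i' := by
  let hS := isSubmodule_preimage j' i'
  have hs (x) (s : (sub hS).obj x) : app i' x s.2.choose = app j' x s.1 := s.2.choose_spec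
  refine ⟨sub hS, subι hS, Hom.mk (fun x s => s.2.choose) (fun x a s => hi' x ?_)
    (fun {x y} h s => hi' y ?_), fun x => Subtype.val_injective, fun x => ⟨fun t => ?_, ?_⟩,
    hom_ext fun x s => (hs x s).symm, ?_⟩
  · rw [hs, app_smul, hs]
    exact app_smul j' x a s.1
  · rw [hs, app_res, hs]
    exact app_res j' h s.1
  · obtain ⟨b, hb⟩ := (hj' x).1 (app i' x t)
    exact ⟨⟨b, t, hb.symm⟩, hi' x ((hs x _).trans hb)⟩
  · have h0 (s : (sub hS).obj x) (hs' : s.2.choose ≠ 0) : app j' x s.1 ≠ 0 := fun h =>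
      hs' (hi' x ((hs x s).trans (h.trans (app_zero i' x).symm)))
    intro s h t h' hst
    refine Subtype.ext ((hj' x).2 (h0 s h) (h0 t h') ?_)
    exact (hs x s).symm.trans ((congrArg (app i' x) hst).trans (hs x t))
  · intro x b a' hb
    exact ⟨⟨b, a', hb.symm⟩, rfl⟩

theorem exists_admissible_pushout (hi : admMono D i) (hj : admEpi D j) :
    ∃ (B' : DMod D) (j' : B ⟶ B') (i' : A' ⟶ B'), admMono D i' ∧ admEpi D j' ∧
      i ≫ j' = j ≫ i' ∧ ContainsPreimage i j' i' := by
  let hS := isSubmodule_image_ker i j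
  choose g hg using fun x => (hj x).1
  have key {x : P} {a c : A.obj x} (h : app j x a = app j x c) :
      app (quotπ hS) x (app i x a) = app (quotπ hS) x (app i x c) := by
    rcases eq_or_eq_zero hj h with rfl | ⟨ha, hc⟩
    · rfl
    · exact (quotπ_eq_iff hS).2 (Or.inr ⟨⟨a, ha, rfl⟩, ⟨c, hc, rfl⟩⟩)
  have key' {x : P} {a c : A.obj x}
      (h : app (quotπ hS) x (app i x a) = app (quotπ hS) x (app i x c)) :
      app j x a = app j x c := by
    rcases (quotπ_eq_iff hS).1 h with h | ⟨⟨a', ha', e⟩, ⟨c', hc', e'⟩⟩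
    · rw [hi x h]
    · rw [← hi x e, ← hi x e', ha', hc']
  refine ⟨quot hS, quotπ hS, Hom.mk (fun x t => app (quotπ hS) x (app i x (g x t)))
    (fun x a t => ?_) (fun {x y} h t => ?_), fun x s t hst => ?_, quotπ_mem_admEpi hS,
    hom_ext fun x a => key (hg x _).symm, ?_⟩
  · rw [← app_smul, ← app_smul]
    exact key (by rw [hg, app_smul, hg])
  · rw [← app_res, ← app_res]
    exact key (by rw [hg, app_res, hg])
  · rw [← hg x s, ← hg x t]
    exact key' hst
  · intro x b a' hb
    rcases (quotπ_eq_iff hS).1 hb with h | ⟨⟨a, -, h⟩, -⟩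
    · exact ⟨g x a', h.symm⟩
    · exact ⟨a, h⟩

theorem containsPreimage_of_isPullback (hi' : admMono D i') (hj' : admEpi D j')
    (hp : IsPullback i j j' i') : ContainsPreimage i j' i' := by
  obtain ⟨A₀, i₀, j₀, hi₀, -, w, h⟩ := exists_admissible_pullback hi' hj'
  intro x b a' hb
  obtain ⟨a, rfl⟩ := h x b a' hb
  refine ⟨app (hp.lift i₀ j₀ w) x a, ?_⟩
  rw [← comp_app, hp.lift_fst]

theorem containsPreimage_of_isPushout (hi : admMono D i) (hj : admEpi D j)
    (hp : IsPushout i j j' i') : ContainsPreimage i j' i' := by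
  obtain ⟨B₀, j₀, i₀, -, -, w, h⟩ := exists_admissible_pushout hi hj
  intro x b a' hb
  refine h x b a' ?_
  rw [← hp.inl_desc j₀ i₀ w, comp_app, hb, ← comp_app, hp.inr_desc]

end Squares

/-- Modules over a diagram of monoids form a proto-exact category. -/
theorem isProtoExact (D : MonoidDiagram P) : IsProtoExact (admMono D) (admEpi D) where
  hasZeroObject := ⟨⟨zeroObj D, isZero_of_forall_eq_zero fun _ _ => rfl⟩⟩
  mono_of_isZero _ _ _ h _ s t _ :=
    (eq_zero_of_isZero h s).trans (eq_zero_of_isZero h t).symm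
  epi_of_isZero _ _ f h x := ⟨fun s => ⟨0, (eq_zero_of_isZero h _).trans
    (eq_zero_of_isZero h s).symm⟩, fun s hs => absurd (eq_zero_of_isZero h (app f x s)) hs⟩
  mono_comp _ _ _ _ _ hf hg x := (hg x).comp (hf x)
  epi_comp _ _ _ f g hf hg x := by
    refine ⟨(hg x).1.comp (hf x).1, fun s hs t ht hst => ?_⟩
    have h0 {s} (hs : app g x (app f x s) ≠ 0) : app f x s ≠ 0 := fun h => hs (by
      rw [h, app_zero])
    exact (hf x).2 (h0 hs) (h0 ht) ((hg x).2 hs ht hst)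
  mono_of_isIso _ _ f _ x := (bijective_of_isIso f x).1
  epi_of_isIso _ _ f _ x :=
    ⟨(bijective_of_isIso f x).2, (bijective_of_isIso f x).1.injOn⟩
  cartesian_iff_cocartesian _ _ _ _ _ _ _ _ sq hi hi' hj hj' :=
    ⟨fun hp => isPushout_of_containsPreimage sq.w hj hi' hj'
        (containsPreimage_of_isPullback hi' hj' hp),
      fun hp => isPullback_of_containsPreimage sq.w hi hi'
        (containsPreimage_of_isPushout hi hj hp)⟩
  exists_pushout _ _ _ i j hi hj := by
    obtain ⟨B', j', i', hi', hj', w, h⟩ := exists_admissible_pushout hi hj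
    exact ⟨B', j', i', hi', hj', isPullback_of_containsPreimage w hi hi' h,
      isPushout_of_containsPreimage w hj hi' hj' h⟩
  exists_pullback _ _ _ j' i' hi' hj' := by
    obtain ⟨A, i, j, hi, hj, w, h⟩ := exists_admissible_pullback hi' hj'
    exact ⟨A, i, j, hi, hj, isPullback_of_containsPreimage w hi hi' h,
      isPushout_of_containsPreimage w hj hi' hj' h⟩

end DMod

end DiagramModules

section Congr

variable {S T S' T' : Type*} {f : S → T} {g : S' → T'}

theorem injective_congr (e : S ≃ S') (e' : T ≃ T') (h : ∀ s, g (e s) = e' (f s)) :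
    Function.Injective f ↔ Function.Injective g := by
  have h' : g ∘ e = e' ∘ f := funext h
  rw [← e'.comp_injective, ← h', e.injective_comp]

theorem isAdmissibleSurjection_congr [Zero T] [Zero T'] (e : S ≃ S') (e' : T ≃ T')
    (h₀ : e' 0 = 0) (h : ∀ s, g (e s) = e' (f s)) :
    IsAdmissibleSurjection f ↔ IsAdmissibleSurjection g := by
  have h' : g ∘ e = e' ∘ f := funext h
  refine and_congr ?_ ?_
  · rw [← e'.comp_surjective, ← h', e.surjective_comp]
  · have hz (s) : g (e s) ≠ 0 ↔ f s ≠ 0 := by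
      rw [h, ← h₀, e'.injective.ne_iff]
    constructor
    · intro hf s hs t ht hst
      obtain ⟨s, rfl⟩ := e.surjective s
      obtain ⟨t, rfl⟩ := e.surjective t
      rw [h, h, e'.injective.eq_iff] at hst
      rw [hf ((hz s).1 hs) ((hz t).1 ht) hst]
    · intro hg s hs t ht hst
      exact e.injective (hg ((hz s).2 hs) ((hz t).2 ht) (by rw [h, h, hst]))

end Congr

/-! ## Sheaves on Alexandrov-discrete spaces -/

section Core

variable {T : Type*} [TopologicalSpace T] [AlexandrovDiscrete T]

/-- The smallest open neighbourhood of a point. -/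
def TopologicalSpace.Opens.core (x : T) : Opens T := ⟨nhdsKer {x}, isOpen_nhdsKer⟩

theorem TopologicalSpace.Opens.core_le_iff {x : T} {U : Opens T} : Opens.core x ≤ U ↔ x ∈ U :=
  U.isOpen.nhdsKer_subset.trans Set.singleton_subset_iff

theorem TopologicalSpace.Opens.mem_core (x : T) : x ∈ Opens.core x :=
  Opens.core_le_iff.1 le_rfl

end Core

namespace OMod

variable {X : MonoidalSpace.{u}}

theorem res_res (F : OMod X) {U V W : Opens X.carrier} (i : V ⟶ U) (j : W ⟶ V) (k : W ⟶ U)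
    (s : F.Γ U) : F.res j (F.res i s) = F.res k s := by
  obtain rfl : k = j ≫ i := Subsingleton.elim _ _
  change _ = F.sheaf.presheaf.map (i.op ≫ j.op) s
  rw [Functor.map_comp]
  rfl

theorem res_self (F : OMod X) {U : Opens X.carrier} (i : U ⟶ U) (s : F.Γ U) : F.res i s = s := by
  obtain rfl : i = 𝟙 U := Subsingleton.elim _ _
  change F.sheaf.presheaf.map (𝟙 (op U)) s = s
  rw [F.sheaf.presheaf.map_id]
  rfl

theorem res_zero_eq (F : OMod X) {U V : Opens X.carrier} (i : V ⟶ U) : F.res i 0 = 0 :=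
  F.res_zero i

theorem res_smul_eq (F : OMod X) {U V : Opens X.carrier} (i : V ⟶ U) (a : X.Γ U) (s : F.Γ U) :
    F.res i (a • s) = X.res i a • F.res i s :=
  F.res_smul i a s

theorem app_res {F G : OMod X} (f : F ⟶ G) {U V : Opens X.carrier} (i : V ⟶ U) (s : F.Γ U) :
    app f V (F.res i s) = G.res i (app f U s) :=
  NatTrans.naturality_apply (presheafHom f) i.op s

theorem app_zero {F G : OMod X} (f : F ⟶ G) (U : Opens X.carrier) : app f U 0 = 0 :=
  Hom.map_zero f U

theorem app_smul {F G : OMod X} (f : F ⟶ G) (U : Opens X.carrier) (a : X.Γ U) (s : F.Γ U) :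
    app f U (a • s) = a • app f U s :=
  Hom.map_smul f U a s

theorem hom_ext {F G : OMod X} {f g : F ⟶ G} (h : ∀ U s, app f U s = app g U s) : f = g :=
  Hom.ext (NatTrans.ext (funext fun U => by
    ext s
    exact h U.unop s))

/-- Construction of a morphism from its maps on sections. -/
def homMk {F G : OMod X} (φ : ∀ U, F.Γ U → G.Γ U)
    (hres : ∀ {U V : Opens X.carrier} (i : V ⟶ U) (s : F.Γ U),
      φ V (F.res i s) = G.res i (φ U s))
    (hzero : ∀ U, φ U 0 = 0) (hsmul : ∀ U (a : X.Γ U) (s : F.Γ U), φ U (a • s) = a • φ U s) :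
    F ⟶ G :=
  Hom.mk
    { app := fun U => TypeCat.ofHom (φ U.unop)
      naturality := fun U V i => by
        ext s
        exact hres i.unop s }
    hzero hsmul

/-- A morphism that is bijective on sections is an isomorphism. -/
theorem isIso_of_bijective {F G : OMod X} (f : F ⟶ G) (h : ∀ U, Function.Bijective (app f U)) :
    IsIso f := by
  have hs (U) (t : G.Γ U) : app f U ((Equiv.ofBijective _ (h U)).symm t) = t :=
    (Equiv.ofBijective _ (h U)).apply_symm_apply t
  refine ⟨homMk (fun U => (Equiv.ofBijective _ (h U)).symm) (fun {U V} i t => (h V).1 ?_)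
    (fun U => (h U).1 ?_) (fun U a t => (h U).1 ?_), hom_ext fun U s => ?_, hom_ext fun U t => ?_⟩
  · rw [hs, app_res, hs]
  · rw [hs, app_zero]
  · rw [hs, app_smul, hs]
  · exact (Equiv.ofBijective _ (h U)).symm_apply_apply s
  · exact hs U t

/-- The zero morphism. -/
def zeroHom (F G : OMod X) : F ⟶ G :=
  homMk (fun _ _ => 0) (fun i _ => (G.res_zero_eq i).symm) (fun _ => rfl)
    fun _ a _ => (smul_zero a).symm

theorem eq_zero_of_isZero {F : OMod X} (h : IsZero F) {U : Opens X.carrier} (s : F.Γ U) :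
    s = 0 :=
  congrArg (fun f : F ⟶ F => app f U s) (h.eq_of_src (𝟙 F) (zeroHom F F))

theorem eq_of_locally_eq (F : OMod X) {ι : Type u} {V : Opens X.carrier}
    (U : ι → Opens X.carrier) (i : ∀ k, U k ⟶ V) (hV : ∀ x ∈ V, ∃ k, x ∈ U k) {s t : F.Γ V}
    (h : ∀ k, F.res (i k) s = F.res (i k) t) : s = t :=
  F.sheaf.eq_of_locally_eq' U V i (fun x hx => Opens.mem_iSup.2 (hV x hx)) s t h

variable [AlexandrovDiscrete X.carrier]

/-- Sections are determined by their restrictions to smallest open neighbourhoods. -/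
theorem eq_of_res_core_eq (F : OMod X) {V : Opens X.carrier} {s t : F.Γ V}
    (h : ∀ (x) (hx : x ∈ V), F.res (homOfLE (Opens.core_le_iff.2 hx)) s =
      F.res (homOfLE (Opens.core_le_iff.2 hx)) t) : s = t :=
  F.eq_of_locally_eq (fun x : V => Opens.core x.1)
    (fun x => homOfLE (Opens.core_le_iff.2 x.2)) (fun x hx => ⟨⟨x, hx⟩, Opens.mem_core x⟩)
    fun x => h x.1 x.2

/-- Compatible sections over smallest open neighbourhoods glue. -/
theorem exists_glue (F : OMod X) {ι : Type u} {V : Opens X.carrier} (pt : ι → X.carrier)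
    (hpt : ∀ k, pt k ∈ V) (hV : ∀ x ∈ V, ∃ k, pt k = x) (s : ∀ k, F.Γ (Opens.core (pt k)))
    (hs : ∀ k l (h : Opens.core (pt l) ≤ Opens.core (pt k)),
      F.res (homOfLE h) (s k) = s l) :
    ∃ t : F.Γ V, ∀ k, F.res (homOfLE (Opens.core_le_iff.2 (hpt k))) t = s k := by
  refine (F.sheaf.existsUnique_gluing' (fun k => Opens.core (pt k)) V
    (fun k => homOfLE (Opens.core_le_iff.2 (hpt k))) (fun x hx => ?_) s ?_).exists
  · obtain ⟨k, rfl⟩ := hV x hx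
    exact Opens.mem_iSup.2 ⟨k, Opens.mem_core _⟩
  · intro k l
    change F.res _ (s k) = F.res _ (s l)
    refine F.eq_of_res_core_eq fun x hx => ?_
    obtain ⟨m, rfl⟩ := hV x (Opens.core_le_iff.2 (hpt k) hx.1)
    rw [F.res_res _ _ (homOfLE (Opens.core_le_iff.2 hx.1)),
      F.res_res _ _ (homOfLE (Opens.core_le_iff.2 hx.2)), hs, hs]

/-- The stalk at `x` consists of the sections over the smallest open neighbourhood of `x`. -/
theorem germ_core_bijective (F : OMod X) (x : X.carrier) :
    Function.Bijective (F.sheaf.presheaf.germ (Opens.core x) x (Opens.mem_core x)) := by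
  constructor
  · intro s t h
    obtain ⟨W, hW, i, i', e⟩ := F.sheaf.presheaf.germ_eq x _ _ s t h
    change F.res i s = F.res i' t at e
    have e' := congrArg (F.res (homOfLE (Opens.core_le_iff.2 hW))) e
    rwa [F.res_res _ _ (𝟙 _), F.res_res _ _ (𝟙 _), res_self, res_self] at e'
  · intro s
    obtain ⟨U, hU, t, rfl⟩ := F.sheaf.presheaf.exists_germ_eq s
    exact ⟨F.res (homOfLE (Opens.core_le_iff.2 hU)) t,
      F.sheaf.presheaf.germ_res_apply _ _ _ _⟩

/-- The stalk at `x` as sections over the smallest open neighbourhood. -/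
def stalkEquiv (F : OMod X) (x : X.carrier) : F.Γ (Opens.core x) ≃ F.stalk x :=
  Equiv.ofBijective _ (F.germ_core_bijective x)

theorem stalkEquiv_zero (F : OMod X) (x : X.carrier) : F.stalkEquiv x 0 = 0 := by
  rw [← F.res_zero_eq (homOfLE le_top)]
  exact F.sheaf.presheaf.germ_res_apply _ _ _ _

theorem stalkMap_stalkEquiv {F G : OMod X} (f : F ⟶ G) (x : X.carrier)
    (s : F.Γ (Opens.core x)) :
    stalkMap f x (F.stalkEquiv x s) = G.stalkEquiv x (app f (Opens.core x) s) :=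
  TopCat.Presheaf.stalkFunctor_map_germ_apply _ _ _ _ _

theorem stalkMap_injective_iff {F G : OMod X} (f : F ⟶ G) (x : X.carrier) :
    Function.Injective (stalkMap f x) ↔ Function.Injective (app f (Opens.core x)) :=
  (injective_congr (F.stalkEquiv x) (G.stalkEquiv x) (stalkMap_stalkEquiv f x)).symm

theorem stalkMap_isAdmissibleSurjection_iff {F G : OMod X} (f : F ⟶ G) (x : X.carrier) :
    IsAdmissibleSurjection (stalkMap f x) ↔ IsAdmissibleSurjection (app f (Opens.core x)) :=
  (isAdmissibleSurjection_congr (F.stalkEquiv x) (G.stalkEquiv x) (G.stalkEquiv_zero x)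
    (stalkMap_stalkEquiv f x)).symm

theorem mem_support_iff (F : OMod X) (x : X.carrier) :
    x ∈ F.support ↔ ∃ s : F.Γ (Opens.core x), s ≠ 0 := by
  constructor
  · rintro ⟨s, hs⟩
    obtain ⟨s, rfl⟩ := (F.stalkEquiv x).surjective s
    exact ⟨s, fun h => hs (by rw [h, stalkEquiv_zero])⟩
  · rintro ⟨s, hs⟩
    exact ⟨F.stalkEquiv x s, by
      rwa [← F.stalkEquiv_zero, (F.stalkEquiv x).injective.ne_iff]⟩

end OMod

/-! ### The diagram of stalks -/

namespace MonoidalSpace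

variable (X : MonoidalSpace.{u})

variable [AlexandrovDiscrete X.carrier]

/-- The points of a space, ordered by generization. -/
instance : Preorder X.carrier := Preorder.lift Opens.core

/-- The diagram of the stalks of the structure sheaf. -/
def stalkDiagram : MonoidDiagram X.carrier where
  obj x := X.Γ (Opens.core x)
  res {x y} h := X.res (homOfLE (show Opens.core y ≤ Opens.core x from h))

end MonoidalSpace

namespace OMod

open MonoidalSpace

variable (X : MonoidalSpace.{u}) [AlexandrovDiscrete X.carrier]

/-- A sheaf of modules gives a module over the diagram of stalks. -/
def toDiagram : OMod X ⥤ DMod X.stalkDiagram where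
  obj F :=
    { obj := fun x => F.Γ (Opens.core x)
      zero := fun x => inferInstanceAs (Zero (F.Γ (Opens.core x)))
      action := fun x => inferInstanceAs (MulActionWithZero (X.Γ (Opens.core x)) (F.Γ (Opens.core x)))
      res := fun {x y} h => F.res (homOfLE (show Opens.core y ≤ Opens.core x from h))
      res_zero := fun _ => F.res_zero _
      res_smul := fun _ => F.res_smul _
      res_refl := fun _ s => F.res_self _ s
      res_trans := fun _ _ s => F.res_res _ _ _ s }
  map f := DMod.Hom.mk (fun x => app f (Opens.core x)) (fun x => app_smul f (Opens.core x))
    fun _ => app_res f _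

variable {X}

/-- The predicate of compatibility on families of elements of the modules of a diagram. -/
def isCompatible (M : DMod X.stalkDiagram) :
    TopCat.LocalPredicate (X := X.carrier) (fun x => M.obj x) where
  pred {U} s := ∀ (x y : X.carrier) (hx : x ∈ U) (hy : y ∈ U) (h : y ≤ x),
    M.res h (s ⟨x, hx⟩) = s ⟨y, hy⟩
  res i _ hs x y hx hy h := hs x y (i.le hx) (i.le hy) h
  locality {U} s hs x y hx hy h := by
    obtain ⟨V, hV, i, hs⟩ := hs ⟨x, hx⟩
    exact hs x y hV (Opens.core_le_iff.2 hV (h (Opens.mem_core y))) h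

/-- The sheaf of modules of a module over the diagram of stalks. -/
def ofDiagram (M : DMod X.stalkDiagram) : OMod X where
  sheaf := TopCat.subsheafToTypes (isCompatible M)
  zero U := ⟨⟨fun x => (0 : M.obj x.1), fun _ _ _ _ h => M.res_zero h⟩⟩
  action U :=
    letI : Zero ((TopCat.subsheafToTypes (isCompatible M)).presheaf.obj (op U)) :=
      ⟨⟨fun x => (0 : M.obj x.1), fun _ _ _ _ h => M.res_zero h⟩⟩
    { smul := fun a s => ⟨fun x => (show X.stalkDiagram.obj x.1 from
          X.res (homOfLE (Opens.core_le_iff.2 x.2)) a) • (show M.obj x.1 from s.1 x), fun x y hx hy h => by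
        rw [M.res_smul, s.2 x y hx hy h]
        congr 1
        exact (structureModule X).res_res _ _ _ a⟩
      one_smul := fun s => Subtype.ext (funext fun x =>
        (congrArg (fun b : X.stalkDiagram.obj x.1 => b • (show M.obj x.1 from s.1 x)) (X.res_one _)).trans
          (one_smul _ (show M.obj x.1 from s.1 x)))
      mul_smul := fun a b s => Subtype.ext (funext fun x =>
        (congrArg (fun b : X.stalkDiagram.obj x.1 => b • (show M.obj x.1 from s.1 x))
          (X.res_mul _ a b)).trans
          (mul_smul _ _ (show M.obj x.1 from s.1 x)))
      smul_zero := fun a => Subtype.ext (funext fun x => smul_zero (A := M.obj x.1) _)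
      zero_smul := fun s => Subtype.ext (funext fun x =>
        (congrArg (fun b : X.stalkDiagram.obj x.1 => b • (show M.obj x.1 from s.1 x))
          (X.res_zero _)).trans
          (zero_smul (X.stalkDiagram.obj x.1) (show M.obj x.1 from s.1 x))) }
  res_zero _ := rfl
  res_smul i a s := Subtype.ext (funext fun x =>
    congrArg (fun b : X.stalkDiagram.obj x.1 => b • (show M.obj x.1 from s.1 (i x)))
      ((structureModule X).res_res i _ _ a).symm)

/-- Evaluation of a section of `ofDiagram M` at a point. -/
def evalOfDiagram (M : DMod X.stalkDiagram) {U : Opens X.carrier} (s : (ofDiagram M).Γ U)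
    (x : X.carrier) (hx : x ∈ U) : M.obj x :=
  (show {t : ∀ x : U, M.obj x.1 // (isCompatible M).pred t} from s).1 ⟨x, hx⟩

theorem res_evalOfDiagram (M : DMod X.stalkDiagram) {U : Opens X.carrier}
    (s : (ofDiagram M).Γ U) {x y : X.carrier} (hx : x ∈ U) (hy : y ∈ U) (h : y ≤ x) :
    M.res h (evalOfDiagram M s x hx) = evalOfDiagram M s y hy :=
  (show {t : ∀ x : U, M.obj x.1 // (isCompatible M).pred t} from s).2 x y hx hy h

theorem evalOfDiagram_ext (M : DMod X.stalkDiagram) {U : Opens X.carrier}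
    {s t : (ofDiagram M).Γ U} (h : ∀ x hx, evalOfDiagram M s x hx = evalOfDiagram M t x hx) :
    s = t :=
  Subtype.ext (funext fun x => h x.1 x.2)

/-- The module over the diagram of stalks of `ofDiagram M` is `M`. -/
def ofDiagramIso (M : DMod X.stalkDiagram) : (toDiagram X).obj (ofDiagram M) ≅ M :=
  DMod.isoOfBijective
    (DMod.Hom.mk (fun x s => evalOfDiagram M s x (Opens.mem_core x))
      (fun x a s => congrArg (fun b : X.stalkDiagram.obj x =>
          b • evalOfDiagram M s x (Opens.mem_core x)) ((structureModule X).res_self _ a))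
      (fun {x y} h s => (res_evalOfDiagram M s _ (h (Opens.mem_core y)) h).symm))
    (fun x => by
      constructor
      · intro s t e
        refine evalOfDiagram_ext M fun y hy => ?_
        have hyx : y ≤ x := Opens.core_le_iff.2 hy
        rw [← res_evalOfDiagram M s (Opens.mem_core x) hy hyx,
          ← res_evalOfDiagram M t (Opens.mem_core x) hy hyx]
        exact congrArg _ e
      · intro m
        exact ⟨(show {t : ∀ y : Opens.core x, M.obj y.1 // (isCompatible M).pred t} from
          ⟨fun y => M.res (x := x) (Opens.core_le_iff.2 y.2) m,
            fun y z _ _ h => M.res_trans _ _ m⟩), M.res_refl x m⟩)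

instance : (toDiagram X).Faithful where
  map_injective {F G f g} h := hom_ext fun U s => G.eq_of_res_core_eq fun x hx => by
    rw [← app_res, ← app_res]
    exact congrArg (fun k => DMod.app k x
      (F.res (homOfLE (Opens.core_le_iff.2 hx)) s)) h

instance : (toDiagram X).Full where
  map_surjective {F G} φ := by
    have hφ {x y : X.carrier} (h : Opens.core y ≤ Opens.core x) (s : F.Γ (Opens.core x)) :
        DMod.app φ y (F.res (homOfLE h) s) =
          G.res (homOfLE h) (DMod.app φ x s) :=
      DMod.app_res φ (x := show X.carrier from x) (y := show X.carrier from y) h s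
    have key (U : Opens X.carrier) (s : F.Γ U) : ∃ t : G.Γ U, ∀ (x) (hx : x ∈ U),
        G.res (homOfLE (Opens.core_le_iff.2 hx)) t =
          DMod.app φ x (F.res (homOfLE (Opens.core_le_iff.2 hx)) s) := by
      obtain ⟨t, ht⟩ := G.exists_glue (V := U) (fun x : U => x.1) (fun x => x.2)
        (fun x hx => ⟨⟨x, hx⟩, rfl⟩) (fun x => DMod.app φ x.1
          (F.res (homOfLE (Opens.core_le_iff.2 x.2)) s)) (fun x y h =>
            (hφ h _).symm.trans (congrArg _ (F.res_res _ _ _ s)))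
      exact ⟨t, fun x hx => ht ⟨x, hx⟩⟩
    choose ψ hψ using key
    refine ⟨homMk ψ (fun {U V} i s => ?_) (fun U => ?_) (fun U a s => ?_), ?_⟩
    · refine G.eq_of_res_core_eq fun x hx => ?_
      rw [hψ V _ x hx, G.res_res _ _ (homOfLE (Opens.core_le_iff.2 (i.le hx))),
        hψ U s x (i.le hx), F.res_res]
    · refine G.eq_of_res_core_eq fun x hx => ?_
      rw [hψ U _ x hx, F.res_zero_eq, G.res_zero_eq]
      exact DMod.app_zero φ _
    · refine G.eq_of_res_core_eq fun x hx => ?_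
      rw [hψ U _ x hx, F.res_smul_eq, G.res_smul_eq, hψ U s x hx]
      exact DMod.app_smul φ _ _ _
    · refine DMod.hom_ext fun x s => ?_
      have h := hψ (Opens.core x) s x (Opens.mem_core x)
      rwa [G.res_self, show F.res (homOfLE _) s = s from F.res_self _ s] at h

instance : (toDiagram X).EssSurj where
  mem_essImage M := ⟨ofDiagram M, ⟨ofDiagramIso M⟩⟩

instance : (toDiagram X).IsEquivalence where

theorem admMono_eq_inverseImage :
    admMono X = (DMod.admMono X.stalkDiagram).inverseImage (toDiagram X) := by
  ext F G f
  exact forall_congr' fun x => stalkMap_injective_iff f x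

theorem admEpi_eq_inverseImage :
    admEpi X = (DMod.admEpi X.stalkDiagram).inverseImage (toDiagram X) := by
  ext F G f
  exact forall_congr' fun x => stalkMap_isAdmissibleSurjection_iff f x

variable (X) in
/-- Sheaves of modules on an Alexandrov-discrete space form a proto-exact category. -/
theorem isProtoExact : IsProtoExact (admMono X) (admEpi X) := by
  rw [admMono_eq_inverseImage, admEpi_eq_inverseImage]
  exact (DMod.isProtoExact _).inverseImage (.of_isEquivalence _ _ _)

/-- The condition on sections that characterizes biCartesian admissible squares. -/
theorem exists_app_eq_of_isPullback {A B A' B' : OMod X} {i : A ⟶ B} {j : A ⟶ A'} {j' : B ⟶ B'}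
    {i' : A' ⟶ B'} (hi' : admMono X i') (hj' : admEpi X j') (h : IsPullback i j j' i')
    (x : X.carrier) (b : B.Γ (Opens.core x)) (a' : A'.Γ (Opens.core x))
    (e : app j' _ b = app i' _ a') : ∃ a, app i (Opens.core x) a = b := by
  rw [admMono_eq_inverseImage] at hi'
  rw [admEpi_eq_inverseImage] at hj'
  exact DMod.containsPreimage_of_isPullback hi' hj' (h.map (toDiagram X)) x b a' e

end OMod

/-! ## Noetherian monoids -/

/-- A monoid is Noetherian if all its ideals are finitely generated. -/
def IsNoetherianMonoid (A : Type*) [CommMonoidWithZero A] : Prop :=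
  ∀ I : Set A, (∀ (a : A), ∀ x ∈ I, a * x ∈ I) →
    ∃ s : Set A, s.Finite ∧ s ⊆ I ∧ ∀ x ∈ I, ∃ a : A, ∃ g ∈ s, x = a * g

theorem exists_eq_prod_pow_of_mem_closure {A : Type*} [CommMonoid A] {S : Set A} [Fintype S]
    {a : A} (ha : a ∈ Submonoid.closure S) : ∃ f : S → ℕ, a = ∏ s : S, (s : A) ^ f s := by
  classical
  induction ha using Submonoid.closure_induction with
  | mem x hx =>
    refine ⟨Pi.single ⟨x, hx⟩ 1, ?_⟩
    rw [Finset.prod_eq_single ⟨x, hx⟩ (fun b _ hb => by rw [Pi.single_eq_of_ne hb, pow_zero])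
      (fun h => absurd (Finset.mem_univ _) h), Pi.single_eq_same, pow_one]
  | one => exact ⟨0, by simp⟩
  | mul x y _ _ hx hy =>
    obtain ⟨f, rfl⟩ := hx
    obtain ⟨g, rfl⟩ := hy
    exact ⟨f + g, by simp [pow_add, Finset.prod_mul_distrib]⟩

/-- Finitely generated monoids are Noetherian (Dickson's lemma). -/
theorem IsNoetherianMonoid.of_fg (A : Type*) [CommMonoidWithZero A] (h : Monoid.FG A) :
    IsNoetherianMonoid A := by
  obtain ⟨S, hS, hfin⟩ := Monoid.fg_iff.1 h
  have := hfin.fintype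
  have hsurj (a : A) : ∃ f : S → ℕ, a = ∏ s : S, (s : A) ^ f s :=
    exists_eq_prod_pow_of_mem_closure (hS ▸ Submonoid.mem_top a)
  intro I hI
  let J : Set (S → ℕ) := {f | ∏ s : S, (s : A) ^ f s ∈ I}
  have hJ : J.IsPWO := Set.isPWO_of_wellQuasiOrderedLE J
  refine ⟨(fun f : S → ℕ => ∏ s : S, (s : A) ^ f s) '' {f | Minimal (· ∈ J) f}, ?_, ?_, ?_⟩
  · refine Set.Finite.image _ ((setOfPred_minimal_antichain (· ∈ J)).finite_of_partiallyWellOrderedOn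
      (hJ.mono fun f hf => hf.1))
  · rintro _ ⟨f, hf, rfl⟩
    exact hf.1
  · intro x hx
    obtain ⟨f, rfl⟩ := hsurj x
    obtain ⟨g, hgf, hg⟩ := hJ.exists_le_minimal hx
    refine ⟨∏ s : S, (s : A) ^ (f s - g s), _, ⟨g, hg, rfl⟩, ?_⟩
    rw [← Finset.prod_mul_distrib]
    refine Finset.prod_congr rfl fun s _ => ?_
    rw [← pow_add, Nat.sub_add_cancel (hgf s)]

/-- A monoid that is obtained from a Noetherian one by inverting elements is Noetherian. -/
theorem IsNoetherianMonoid.of_hom {A B : Type*} [CommMonoidWithZero A] [CommMonoidWithZero B]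
    (hA : IsNoetherianMonoid A) (φ : A →*₀ B) (h : ∀ x : B, ∃ a u, IsUnit (φ u) ∧ x * φ u = φ a) :
    IsNoetherianMonoid B := by
  intro I hI
  obtain ⟨s, hs, hsI, hgen⟩ := hA (φ ⁻¹' I) fun a x hx => by
    rw [Set.mem_preimage, map_mul]
    exact hI _ _ hx
  refine ⟨φ '' s, hs.image φ, Set.image_subset_iff.2 hsI, fun x hx => ?_⟩
  obtain ⟨a, u, hu, e⟩ := h x
  obtain ⟨b, g, hg, rfl⟩ := hgen a (by
    rw [Set.mem_preimage, ← e, mul_comm]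
    exact hI _ _ hx)
  obtain ⟨v, hv⟩ := hu.exists_right_inv
  refine ⟨v * φ b, φ g, ⟨g, hg, rfl⟩, ?_⟩
  rw [mul_assoc, ← map_mul, ← e, ← mul_assoc, mul_comm v, mul_assoc, mul_comm v, hv, mul_one]

/-- Finite generation of a pointed set with an action. -/
def IsFGAction (A M : Type*) [CommMonoidWithZero A] [Zero M] [MulActionWithZero A M] : Prop :=
  ∃ s : Set M, s.Finite ∧ ∀ m : M, ∃ a : A, ∃ g ∈ s, m = a • g

section FG

variable {A M N : Type*} [CommMonoidWithZero A] [Zero M] [MulActionWithZero A M] [Zero N]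
  [MulActionWithZero A N]

theorem IsFGAction.of_surjective (h : IsFGAction A M) (f : M → N)
    (hf : ∀ (a : A) m, f (a • m) = a • f m) (hs : Function.Surjective f) : IsFGAction A N := by
  obtain ⟨s, hfin, hgen⟩ := h
  refine ⟨f '' s, hfin.image f, fun n => ?_⟩
  obtain ⟨m, rfl⟩ := hs n
  obtain ⟨a, g, hg, rfl⟩ := hgen m
  exact ⟨a, f g, ⟨g, hg, rfl⟩, hf a g⟩

/-- Submodules of finitely generated modules over Noetherian monoids are finitely generated. -/
theorem IsFGAction.of_injective (hA : IsNoetherianMonoid A) (h : IsFGAction A N) (f : M → N)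
    (hf : ∀ (a : A) m, f (a • m) = a • f m) (hi : Function.Injective f) : IsFGAction A M := by
  obtain ⟨s, hfin, hgen⟩ := h
  have key (g : N) : ∃ t : Set A, t.Finite ∧ t ⊆ {a | a • g ∈ Set.range f} ∧
      ∀ x ∈ {a : A | a • g ∈ Set.range f}, ∃ a : A, ∃ b ∈ t, x = a * b :=
    hA _ fun a x ⟨m, hm⟩ => ⟨a • m, by rw [hf, hm, mul_smul]⟩
  choose t ht hts htgen using key
  refine ⟨f ⁻¹' ⋃ g ∈ s, (· • g) '' t g, ?_, fun m => ?_⟩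
  · exact (hfin.biUnion fun g _ => (ht g).image _).preimage hi.injOn
  · obtain ⟨a, g, hg, e⟩ := hgen (f m)
    obtain ⟨b, c, hc, rfl⟩ := htgen g a ⟨m, e⟩
    obtain ⟨n, hn⟩ := hts g hc
    refine ⟨b, n, Set.mem_biUnion hg ⟨c, hc, hn.symm⟩, hi ?_⟩
    rw [e, hf, hn, mul_smul]

end FG

/-! ## Prime spectra -/

namespace MSpec

variable {A : Type u} [CommMonoidWithZero A]

/-- The spectrum of a finitely generated monoid is finite. -/
theorem finite_of_fg (h : Monoid.FG A) : Finite (MSpec A) := by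
  obtain ⟨S, hS, hfin⟩ := Monoid.fg_iff.1 h
  have := hfin.to_subtype
  refine Finite.of_injective (fun p : MSpec A => {s : S | s.1 ∈ p.asIdeal}) fun p q hpq => ?_
  refine MSpec.ext (Set.ext fun a => ?_)
  have ha : a ∈ Submonoid.closure S := hS ▸ Submonoid.mem_top a
  induction ha using Submonoid.closure_induction with
  | mem x hx => exact Set.ext_iff.1 hpq ⟨x, hx⟩
  | one => exact iff_of_false p.one_notMem q.one_notMem
  | mul x y _ _ hx hy =>
    have hmul (r : MSpec A) : x * y ∈ r.asIdeal ↔ x ∈ r.asIdeal ∨ y ∈ r.asIdeal :=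
      ⟨r.mem_or_mem, fun h => h.elim (fun h => mul_comm x y ▸ r.mul_mem y h) (r.mul_mem x)⟩
    exact (hmul p).trans ((or_congr hx hy).trans (hmul q).symm)

/-- Open sets are stable under generization. -/
theorem mem_of_le {U : Opens (MSpec A)} {p q : MSpec A} (h : q.asIdeal ⊆ p.asIdeal)
    (hp : p ∈ U) : q ∈ U := by
  obtain ⟨s, hs⟩ := (isClosed_iff _).1 U.isOpen.isClosed_compl
  by_contra hq
  exact ((hs ▸ (show q ∈ (U : Set (MSpec A))ᶜ from hq) : q ∈ zeroLocus s).trans h |>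
    fun hp' => (show p ∈ (U : Set (MSpec A))ᶜ from hs ▸ hp')) hp

/-- The basic open set of an element. -/
def basicOpen (f : A) : Opens (MSpec A) :=
  ⟨(zeroLocus {f})ᶜ, ((isClosed_iff _).2 ⟨_, rfl⟩).isOpen_compl⟩

theorem mem_basicOpen {f : A} {p : MSpec A} : p ∈ basicOpen f ↔ f ∉ p.asIdeal :=
  not_congr Set.singleton_subset_iff

/-- The closed point of the spectrum of a nontrivial monoid: the ideal of nonunits. -/
def closedPoint (A : Type u) [CommMonoidWithZero A] [Nontrivial A] : MSpec A where
  asIdeal := {a | ¬ IsUnit a}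
  zero_mem := not_isUnit_zero
  mul_mem a x hx h := hx (isUnit_of_mul_isUnit_right h)
  one_notMem h := h isUnit_one
  mem_or_mem {x y} h := by
    by_contra hxy
    simp only [Set.mem_ofPred_eq, not_or, not_not] at hxy
    exact h (hxy.1.mul hxy.2)

theorem le_closedPoint [Nontrivial A] (p : MSpec A) :
    p.asIdeal ⊆ (closedPoint A).asIdeal := by
  intro x hx h
  obtain ⟨y, hy⟩ := h.exists_left_inv
  exact p.one_notMem (hy ▸ p.mul_mem y hx)

theorem nontrivial (p : MSpec A) : Nontrivial A :=
  ⟨0, 1, fun h => p.one_notMem (h ▸ p.zero_mem)⟩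

end MSpec

/-! ## Fractions and sections of `M~` -/

namespace MSpec

variable {A : Type u} [CommMonoidWithZero A] {M N : Type u} [Zero M] [MulActionWithZero A M]
  [Zero N] [MulActionWithZero A N]

/-- The fraction `m / f` in the localization at a prime. -/
def frac (p : MSpec A) (m : M) (f : A) (hf : f ∉ p.asIdeal) : localizationAt A M p :=
  OreLocalization.oreDiv (S := p.primeCompl) m ⟨f, hf⟩

theorem exists_frac (p : MSpec A) (x : localizationAt A M p) : ∃ m f hf, x = frac p m f hf := by
  induction x using OreLocalization.ind with
  | _ m s => exact ⟨m, s.1, s.2, rfl⟩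

theorem mul_notMem {p : MSpec A} {f g : A} (hf : f ∉ p.asIdeal) (hg : g ∉ p.asIdeal) :
    f * g ∉ p.asIdeal := fun h => (p.mem_or_mem h).elim hf hg

theorem frac_eq_iff (p : MSpec A) {m m' : M} {f f' : A} {hf : f ∉ p.asIdeal}
    {hf' : f' ∉ p.asIdeal} :
    frac p m f hf = frac p m' f' hf' ↔ ∃ u ∉ p.asIdeal, u • f' • m = u • f • m' := by
  rw [frac, frac, OreLocalization.oreDiv_eq_iff]
  constructor
  · rintro ⟨u, v, h₁, h₂⟩
    change u.1 • m' = v • m at h₁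
    change u.1 * f' = v * f at h₂
    refine ⟨u, u.2, ?_⟩
    rw [← mul_smul, h₂, mul_comm v, mul_smul, ← h₁, smul_comm]
  · rintro ⟨u, hu, h⟩
    refine ⟨⟨u * f, mul_notMem hu hf⟩, u * f', ?_, ?_⟩
    · change (u * f) • m' = (u * f') • m
      rw [mul_smul, mul_smul, h]
    · change u * f * f' = u * f' * f
      rw [mul_right_comm]

theorem frac_smul_frac (p : MSpec A) (a : A) (m : M) {f g : A} (hf : f ∉ p.asIdeal)
    (hg : g ∉ p.asIdeal) :
    frac p a f hf • frac p m g hg = frac p (a • m) (f * g) (mul_notMem hf hg) := by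
  rw [frac, frac, OreLocalization.oreDiv_smul_char a m ⟨f, hf⟩ ⟨g, hg⟩ a ⟨g, hg⟩ (mul_comm _ _),
    frac]
  congr 1
  exact Subtype.ext (mul_comm g f)

theorem frac_mul_frac (p : MSpec A) (a b : A) {f g : A} (hf : f ∉ p.asIdeal)
    (hg : g ∉ p.asIdeal) :
    frac p a f hf * frac p b g hg = frac p (a * b) (f * g) (mul_notMem hf hg) :=
  frac_smul_frac p a b hf hg

theorem frac_zero (p : MSpec A) {f : A} (hf : f ∉ p.asIdeal) : frac p (0 : M) f hf = 0 :=
  OreLocalization.zero_oreDiv_of_mulActionWithZero _ _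

theorem frac_one (p : MSpec A) {f : A} (hf : f ∉ p.asIdeal) : frac p f f hf = 1 :=
  OreLocalization.div_eq_one (S := p.primeCompl) (s := ⟨f, hf⟩)

theorem map_frac (p : MSpec A) (φ : M →[A] N) (m : M) {f : A} (hf : f ∉ p.asIdeal) :
    OreLocalization.mapActionHom p.primeCompl φ (frac p m f hf) = frac p (φ m) f hf := rfl

end MSpec

section Eval

open MSpec

variable {A : Type u} [CommMonoidWithZero A] {M N : AMod A}

/-- The value of a section of `M~` at a prime. -/
def tildeEval {U : Opens (mSpec A).carrier} (s : (tildeObj M).Γ U) (p : MSpec A) (hp : p ∈ U) :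
    localizationAt A M.carrier p :=
  (show tildeSections A M.carrier U from s).1 ⟨p, hp⟩

/-- The value of a section of the structure sheaf at a prime. -/
def mSpecEval {U : Opens (mSpec A).carrier} (s : (mSpec A).Γ U) (p : MSpec A) (hp : p ∈ U) :
    localizationAt A A p :=
  (show tildeSections A A U from s).1 ⟨p, hp⟩

theorem tildeEval_ext {U : Opens (mSpec A).carrier} {s t : (tildeObj M).Γ U}
    (h : ∀ p hp, tildeEval s p hp = tildeEval t p hp) : s = t :=
  Subtype.ext (funext fun p => h p.1 p.2)

theorem mSpecEval_ext {U : Opens (mSpec A).carrier} {s t : (mSpec A).Γ U}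
    (h : ∀ p hp, mSpecEval s p hp = mSpecEval t p hp) : s = t :=
  Subtype.ext (funext fun p => h p.1 p.2)

theorem tildeEval_zero {U : Opens (mSpec A).carrier} (p : MSpec A) (hp : p ∈ U) :
    tildeEval (0 : (tildeObj M).Γ U) p hp = 0 := rfl

theorem mSpecEval_one {U : Opens (mSpec A).carrier} (p : MSpec A) (hp : p ∈ U) :
    mSpecEval (1 : (mSpec A).Γ U) p hp = 1 := rfl

theorem mSpecEval_mul {U : Opens (mSpec A).carrier} (a b : (mSpec A).Γ U) (p : MSpec A) (hp : p ∈ U) :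
    mSpecEval (a * b) p hp = mSpecEval a p hp * mSpecEval b p hp := rfl

theorem tildeEval_smul {U : Opens (mSpec A).carrier} (a : (mSpec A).Γ U) (s : (tildeObj M).Γ U)
    (p : MSpec A) (hp : p ∈ U) :
    tildeEval (a • s) p hp = mSpecEval a p hp • tildeEval s p hp := rfl

theorem tildeEval_res {U V : Opens (mSpec A).carrier} (i : V ⟶ U) (s : (tildeObj M).Γ U)
    (p : MSpec A) (hp : p ∈ V) :
    tildeEval ((tildeObj M).res i s) p hp = tildeEval s p (i.le hp) := rfl

/-- On the generizations of a point, a section is a fraction. -/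
theorem exists_tildeEval_eq_frac {U : Opens (mSpec A).carrier} (s : (tildeObj M).Γ U) {p : MSpec A}
    (hp : p ∈ U) : ∃ (m : M.carrier) (f : A), ∀ (q : MSpec A) (h : q.asIdeal ⊆ p.asIdeal),
      ∃ hf, tildeEval s q (mem_of_le h hp) = frac q m f hf := by
  obtain ⟨V, hV, i, m, f, h⟩ := (show tildeSections A M.carrier U from s).2 ⟨p, hp⟩
  exact ⟨m, f, fun q hq => h ⟨q, mem_of_le hq hV⟩⟩

theorem exists_mSpecEval_eq_frac {U : Opens (mSpec A).carrier} (s : (mSpec A).Γ U) {p : MSpec A}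
    (hp : p ∈ U) : ∃ (a : A) (f : A), ∀ (q : MSpec A) (h : q.asIdeal ⊆ p.asIdeal),
      ∃ hf, mSpecEval s q (mem_of_le h hp) = frac q a f hf := by
  obtain ⟨V, hV, i, m, f, h⟩ := (show tildeSections A A U from s).2 ⟨p, hp⟩
  exact ⟨m, f, fun q hq => h ⟨q, mem_of_le hq hV⟩⟩

/-- Sections from families that are locally fractions. -/
theorem exists_tildeEval_eq {U : Opens (mSpec A).carrier}
    (t : ∀ p : MSpec A, p ∈ U → localizationAt A M.carrier p)
    (ht : ∀ p ∈ U, ∃ V : Opens (mSpec A).carrier, p ∈ V ∧ ∃ (m : M.carrier) (f : A), ∀ q (hq : q ∈ U),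
      q ∈ V → ∃ hf, t q hq = frac q m f hf) :
    ∃ s : (tildeObj M).Γ U, ∀ p hp, tildeEval s p hp = t p hp :=
  ⟨(show tildeSections A M.carrier U from ⟨fun p => t p.1 p.2, fun p => by
    obtain ⟨V, hV, m, f, h⟩ := ht p.1 p.2
    exact ⟨U ⊓ V, ⟨p.2, hV⟩, homOfLE inf_le_left, m, f, fun q => h q.1 q.2.1 q.2.2⟩⟩),
    fun _ _ => rfl⟩

/-- The section `m / f` of `M~`. -/
def fracSection (M : AMod A) (U : Opens (mSpec A).carrier) (m : M.carrier) (f : A)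
    (hf : ∀ p ∈ U, f ∉ p.asIdeal) : (tildeObj M).Γ U :=
  (show tildeSections A M.carrier U from ⟨fun p => frac p.1 m f (hf p.1 p.2),
    isLocallyFraction_of_isFraction ⟨m, f, fun p => ⟨hf p.1 p.2, rfl⟩⟩⟩)

/-- The section `a / f` of the structure sheaf. -/
def mSpecFracSection (U : Opens (mSpec A).carrier) (a f : A) (hf : ∀ p ∈ U, f ∉ p.asIdeal) :
    (mSpec A).Γ U :=
  (show tildeSections A A U from ⟨fun p => frac p.1 a f (hf p.1 p.2),
    isLocallyFraction_of_isFraction ⟨a, f, fun p => ⟨hf p.1 p.2, rfl⟩⟩⟩)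

theorem mSpecEval_mSpecFracSection (U : Opens (mSpec A).carrier) (a f : A)
    (hf : ∀ p ∈ U, f ∉ p.asIdeal) (p : MSpec A) (hp : p ∈ U) :
    mSpecEval (mSpecFracSection U a f hf) p hp = frac p a f (hf p hp) := rfl

/-- Sections over the generizations of a point are determined by their value there. -/
theorem tildeEval_injective {U : Opens (mSpec A).carrier} {p : MSpec A} (hp : p ∈ U)
    (hU : ∀ q ∈ U, q.asIdeal ⊆ p.asIdeal) {s t : (tildeObj M).Γ U}
    (h : tildeEval s p hp = tildeEval t p hp) : s = t := by
  refine tildeEval_ext fun q hq => ?_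
  obtain ⟨m, f, hs⟩ := exists_tildeEval_eq_frac s hp
  obtain ⟨m', f', ht⟩ := exists_tildeEval_eq_frac t hp
  obtain ⟨hf, e⟩ := hs q (hU q hq)
  obtain ⟨hf', e'⟩ := ht q (hU q hq)
  obtain ⟨_, e₀⟩ := hs p subset_rfl
  obtain ⟨_, e₀'⟩ := ht p subset_rfl
  rw [e, e', frac_eq_iff]
  obtain ⟨u, hu, hh⟩ := (frac_eq_iff p).1 (e₀.symm.trans (h.trans e₀'))
  exact ⟨u, fun h' => hu (hU q hq h'), hh⟩

theorem mSpecEval_injective {U : Opens (mSpec A).carrier} {p : MSpec A} (hp : p ∈ U)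
    (hU : ∀ q ∈ U, q.asIdeal ⊆ p.asIdeal) {s t : (mSpec A).Γ U}
    (h : mSpecEval s p hp = mSpecEval t p hp) : s = t := by
  refine mSpecEval_ext fun q hq => ?_
  obtain ⟨m, f, hs⟩ := exists_mSpecEval_eq_frac s hp
  obtain ⟨m', f', ht⟩ := exists_mSpecEval_eq_frac t hp
  obtain ⟨hf, e⟩ := hs q (hU q hq)
  obtain ⟨hf', e'⟩ := ht q (hU q hq)
  obtain ⟨_, e₀⟩ := hs p subset_rfl
  obtain ⟨_, e₀'⟩ := ht p subset_rfl
  rw [e, e', frac_eq_iff]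
  obtain ⟨u, hu, hh⟩ := (frac_eq_iff p).1 (e₀.symm.trans (h.trans e₀'))
  exact ⟨u, fun h' => hu (hU q hq h'), hh⟩

/-- The constant sections of the structure sheaf. -/
def mSpecConst (U : Opens (mSpec A).carrier) : A →*₀ (mSpec A).Γ U where
  toFun a := mSpecFracSection U a 1 fun p _ => p.one_notMem
  map_zero' := mSpecEval_ext fun p _ => frac_zero p p.one_notMem
  map_one' := mSpecEval_ext fun p _ => frac_one p p.one_notMem
  map_mul' a b := mSpecEval_ext fun p hp => by
    rw [mSpecEval_mul, mSpecEval_mSpecFracSection, mSpecEval_mSpecFracSection,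
      mSpecEval_mSpecFracSection, frac_mul_frac]
    congr 1
    rw [one_mul]

theorem mSpecEval_mSpecConst (U : Opens (mSpec A).carrier) (a : A) (p : MSpec A) (hp : p ∈ U) :
    mSpecEval (mSpecConst U a) p hp = frac p a 1 p.one_notMem := rfl

theorem isUnit_mSpecConst_iff {U : Opens (mSpec A).carrier} {p : MSpec A} (hp : p ∈ U)
    (hU : ∀ q ∈ U, q.asIdeal ⊆ p.asIdeal) (f : A) :
    IsUnit (mSpecConst U f) ↔ f ∉ p.asIdeal := by
  constructor
  · intro h
    obtain ⟨b, hb⟩ := h.exists_right_inv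
    have hb' := congrArg (fun s => mSpecEval s p hp) hb
    obtain ⟨c, g, hg, e⟩ := exists_frac p (mSpecEval b p hp)
    simp only [mSpecEval_mul, mSpecEval_mSpecConst, e, frac_mul_frac] at hb'
    rw [mSpecEval_one, ← frac_one p p.one_notMem, frac_eq_iff] at hb'
    obtain ⟨u, hu, hh⟩ := hb'
    intro hf
    simp only [smul_eq_mul, one_mul, mul_one] at hh
    refine mul_notMem hu hg (hh ▸ ?_)
    rw [mul_comm f, ← mul_assoc]
    exact p.mul_mem _ hf
  · intro hf
    refine IsUnit.of_mul_eq_one (mSpecFracSection U 1 f fun q hq h => hf (hU q hq h))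
      (mSpecEval_ext fun q hq => ?_)
    have hfq : f ∉ q.asIdeal := fun h => hf (hU q hq h)
    rw [mSpecEval_mul, mSpecEval_mSpecFracSection, mSpecEval_mSpecConst, frac_mul_frac,
      mSpecEval_one, ← frac_one q hfq]
    congr 1
    · rw [mul_one]
    · rw [one_mul]

end Eval

/-! ## Charts and smallest neighbourhoods -/

namespace MonoidalSpace

variable (X : MonoidalSpace.{u})

/-- Restriction as a homomorphism. -/
def resHom {U V : Opens X.carrier} (i : V ⟶ U) : X.Γ U →*₀ X.Γ V where
  toFun := X.res i
  map_zero' := X.res_zero i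
  map_one' := X.res_one i
  map_mul' := X.res_mul i

end MonoidalSpace

theorem OMod.res_smul_resHom {X : MonoidalSpace.{u}} (F : OMod X) {U V : Opens X.carrier}
    (i : V ⟶ U) (a : X.Γ U) (s : F.Γ U) : F.res i (a • s) = X.resHom i a • F.res i s :=
  F.res_smul i a s

theorem IsUnit.smul_cancel_mulAction {A M : Type*} [Monoid A] [MulAction A M] {a : A}
    (ha : IsUnit a) {s t : M} (h : a • s = a • t) : s = t := by
  obtain ⟨b, hb⟩ := ha.exists_left_inv
  rw [← one_smul A s, ← one_smul A t, ← hb, mul_smul, mul_smul, h]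

namespace OpenImmersion

open MSpec MonoidalSpace

variable {X : MonoidalSpace.{u}} {A : Type u} [CommMonoidWithZero A]
  (j : OpenImmersion (mSpec A) X)

/-- The point of `X` that corresponds to a prime. -/
def pt (p : MSpec A) : X.carrier := j.map p

theorem pt_injective : Function.Injective j.pt := j.isOpenEmbedding.injective

theorem exists_eq_pt_of_mem {x : X.carrier} (hx : x ∈ Set.range j.map) : ∃ p, j.pt p = x := hx

theorem comap_resHom {V W : Opens X.carrier} (i : W ⟶ V) (a : X.Γ V) :
    j.comap W (X.resHom i a) = (mSpec A).resHom ((Opens.map j.map).map i) (j.comap V a) :=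
  j.comap_res i a

variable [AlexandrovDiscrete X.carrier]

/-- The smallest open neighbourhood of the image of a prime. -/
def nbhd (p : MSpec A) : Opens X.carrier := Opens.core (j.pt p)

theorem pt_mem_nbhd (p : MSpec A) : j.pt p ∈ j.nbhd p := Opens.mem_core _

theorem nbhd_le_iff {p : MSpec A} {U : Opens X.carrier} : j.nbhd p ≤ U ↔ j.pt p ∈ U :=
  Opens.core_le_iff

theorem nbhd_subset_range (p : MSpec A) :
    (j.nbhd p : Set X.carrier) ⊆ Set.range j.map :=
  Opens.core_le_iff (U := ⟨_, j.isOpenEmbedding.isOpen_range⟩) |>.2 ⟨p, rfl⟩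

theorem pt_mem_nbhd_iff {p q : MSpec A} : j.pt q ∈ j.nbhd p ↔ q.asIdeal ⊆ p.asIdeal := by
  constructor
  · intro h f hfq
    by_contra hfp
    have hle : j.nbhd p ≤ ⟨j.map '' (basicOpen f : Set (MSpec A)),
        j.isOpenEmbedding.isOpenMap _ (basicOpen f).isOpen⟩ :=
      j.nbhd_le_iff.2 ⟨p, mem_basicOpen.2 hfp, rfl⟩
    obtain ⟨r, hr, e⟩ := hle h
    obtain rfl : r = q := j.pt_injective e
    exact mem_basicOpen.1 hr hfq
  · intro h
    exact mem_of_le (U := (Opens.map j.map).obj (j.nbhd p)) h (j.pt_mem_nbhd p)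

theorem nbhd_le_nbhd {p q : MSpec A} (h : q.asIdeal ⊆ p.asIdeal) : j.nbhd q ≤ j.nbhd p :=
  j.nbhd_le_iff.2 (j.pt_mem_nbhd_iff.2 h)

theorem le_of_mem_preimage_nbhd {p q : MSpec A} (h : q ∈ (Opens.map j.map).obj (j.nbhd p)) :
    q.asIdeal ⊆ p.asIdeal := j.pt_mem_nbhd_iff.1 h

theorem mem_preimage_nbhd (p : MSpec A) : p ∈ (Opens.map j.map).obj (j.nbhd p) :=
  j.pt_mem_nbhd p

/-- The homomorphism from the monoid of the chart to the stalk at a point of the chart. -/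
def coord (p : MSpec A) : A →*₀ X.Γ (j.nbhd p) :=
  MonoidWithZeroHom.comp
    (MulEquiv.ofBijective (j.comap (j.nbhd p))
      (j.bijective _ (j.nbhd_subset_range p))).symm.toMonoidWithZeroHom (mSpecConst _)

theorem comap_coord (p : MSpec A) (a : A) :
    j.comap (j.nbhd p) (j.coord p a) = mSpecConst _ a :=
  (MulEquiv.ofBijective (j.comap (j.nbhd p))
    (j.bijective _ (j.nbhd_subset_range p))).apply_symm_apply _

theorem comap_nbhd_injective (p : MSpec A) : Function.Injective (j.comap (j.nbhd p)) :=
  (j.bijective _ (j.nbhd_subset_range p)).1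

theorem resHom_coord {p q : MSpec A} (h : q.asIdeal ⊆ p.asIdeal) (a : A) :
    X.resHom (homOfLE (j.nbhd_le_nbhd h)) (j.coord p a) = j.coord q a := by
  apply j.comap_nbhd_injective
  rw [comap_resHom, comap_coord, comap_coord]
  rfl

theorem isUnit_coord_iff {p : MSpec A} (f : A) : IsUnit (j.coord p f) ↔ f ∉ p.asIdeal := by
  rw [← isUnit_mSpecConst_iff (j.mem_preimage_nbhd p) (fun q => j.le_of_mem_preimage_nbhd) f,
    ← j.comap_coord p f]
  exact (MulEquiv.isUnit_map (MulEquiv.ofBijective (j.comap (j.nbhd p))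
    (j.bijective _ (j.nbhd_subset_range p)))).symm

theorem mul_coord_eq {p : MSpec A} {a : X.Γ (j.nbhd p)} {b g : A} {hg : g ∉ p.asIdeal}
    (h : mSpecEval (j.comap _ a) p (j.mem_preimage_nbhd p) = frac p b g hg) :
    a * j.coord p g = j.coord p b := by
  apply j.comap_nbhd_injective
  refine mSpecEval_injective (j.mem_preimage_nbhd p) (fun q => j.le_of_mem_preimage_nbhd) ?_
  rw [map_mul, comap_coord, comap_coord, mSpecEval_mul, h, mSpecEval_mSpecConst,
    mSpecEval_mSpecConst, frac_mul_frac, frac_eq_iff]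
  refine ⟨1, p.one_notMem, ?_⟩
  simp only [smul_eq_mul]
  rw [one_mul, one_mul, one_mul, mul_one, mul_comm]

theorem exists_mul_coord_eq (p : MSpec A) (a : X.Γ (j.nbhd p)) :
    ∃ b g, IsUnit (j.coord p g) ∧ a * j.coord p g = j.coord p b := by
  obtain ⟨b, g, hg, e⟩ := exists_frac p (mSpecEval (j.comap _ a) p (j.mem_preimage_nbhd p))
  exact ⟨b, g, (j.isUnit_coord_iff g).2 hg, j.mul_coord_eq e⟩

/-- A point in the smallest neighbourhood of a point of a chart is a generization in the chart. -/
theorem exists_pt_of_le {p : MSpec A} {y : X.carrier} (h : Opens.core y ≤ j.nbhd p) :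
    ∃ q, j.pt q = y ∧ q.asIdeal ⊆ p.asIdeal := by
  have hy := h (Opens.mem_core y)
  obtain ⟨q, rfl⟩ := j.exists_eq_pt_of_mem (j.nbhd_subset_range p hy)
  exact ⟨q, rfl, j.pt_mem_nbhd_iff.1 hy⟩

end OpenImmersion

/-- The space of a monoid scheme of finite type is finite. -/
theorem MonoidalSpace.IsFiniteType.finite {X : MonoidalSpace.{u}} (h : X.IsFiniteType) :
    Finite X.carrier := by
  obtain ⟨n, c, hc, hX⟩ := h
  have (k : Fin n) : Finite (MSpec (c k).A) := MSpec.finite_of_fg (hc k)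
  refine Finite.of_surjective
    (fun z : Σ k : Fin n, MSpec (c k).A => ((c z.1).immersion.map z.2 : X.carrier)) fun x => ?_
  obtain ⟨k, p, hp⟩ := hX x
  exact ⟨⟨k, p⟩, hp⟩

/-- The stalks of a monoid scheme of finite type are Noetherian. -/
theorem MonoidalSpace.IsFiniteType.isNoetherianMonoid {X : MonoidalSpace.{u}}
    [AlexandrovDiscrete X.carrier] (h : X.IsFiniteType) (x : X.carrier) :
    IsNoetherianMonoid (X.Γ (Opens.core x)) := by
  obtain ⟨n, c, hc, hX⟩ := h
  obtain ⟨k, p, rfl⟩ := hX x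
  exact (IsNoetherianMonoid.of_fg _ (hc k)).of_hom ((c k).immersion.coord p)
    ((c k).immersion.exists_mul_coord_eq p)

/-! ## Quasicoherence in terms of stalks -/

namespace OMod

open MSpec MonoidalSpace

variable {X : MonoidalSpace.{u}} [AlexandrovDiscrete X.carrier]

/-- The stalks at generizations are localizations. -/
structure IsLocalizing (F : OMod X) : Prop where
  exists_smul_eq {x y : X.carrier} (h : Opens.core y ≤ Opens.core x) (t : F.Γ (Opens.core y)) :
    ∃ a : X.Γ (Opens.core x), IsUnit (X.resHom (homOfLE h) a) ∧
      ∃ s : F.Γ (Opens.core x), X.resHom (homOfLE h) a • t = F.res (homOfLE h) s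
  exists_smul_eq_smul {x y : X.carrier} (h : Opens.core y ≤ Opens.core x)
    (s s' : F.Γ (Opens.core x)) (hs : F.res (homOfLE h) s = F.res (homOfLE h) s') :
    ∃ a : X.Γ (Opens.core x), IsUnit (X.resHom (homOfLE h) a) ∧ a • s = a • s'

/-- The stalks are finitely generated. -/
def HasFGStalks (F : OMod X) : Prop :=
  ∀ x : X.carrier, IsFGAction (X.Γ (Opens.core x)) (F.Γ (Opens.core x))

section RestrictionIso

variable {A : Type u} [CommMonoidWithZero A] {j : OpenImmersion (mSpec A) X} {F : OMod X}
  {M : AMod A} (e : j.RestrictionIso F (tildeObj M))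

/-- The value of a section in a chart. -/
def chartEval (p : MSpec A) (s : F.Γ (j.nbhd p)) : localizationAt A M.carrier p :=
  tildeEval (e.equiv _ (j.nbhd_subset_range p) s) p (j.mem_preimage_nbhd p)

theorem chartEval_injective (p : MSpec A) : Function.Injective (chartEval e p) :=
  fun _ _ h => (e.equiv _ (j.nbhd_subset_range p)).injective
    (tildeEval_injective (j.mem_preimage_nbhd p) (fun _ => j.le_of_mem_preimage_nbhd) h)

/-- The section of `F` that corresponds to an element of the module. -/
def chartSection (p : MSpec A) (m : M.carrier) : F.Γ (j.nbhd p) :=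
  (e.equiv _ (j.nbhd_subset_range p)).symm
    (fracSection M _ m 1 fun q _ => q.one_notMem)

theorem equiv_chartSection (p : MSpec A) (m : M.carrier) :
    e.equiv _ (j.nbhd_subset_range p) (chartSection e p m) =
      fracSection M _ m 1 fun q _ => q.one_notMem :=
  Equiv.apply_symm_apply _ _

theorem chartEval_chartSection (p : MSpec A) (m : M.carrier) :
    chartEval e p (chartSection e p m) = frac p m 1 p.one_notMem := by
  rw [chartEval, equiv_chartSection]
  rfl

theorem chartEval_smul (p : MSpec A) (a : X.Γ (j.nbhd p)) (s : F.Γ (j.nbhd p)) :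
    chartEval e p (a • s) =
      mSpecEval (j.comap _ a) p (j.mem_preimage_nbhd p) • chartEval e p s := by
  rw [chartEval, e.map_smul]
  rfl

theorem chartEval_coord_smul (p : MSpec A) (a : A) (s : F.Γ (j.nbhd p)) :
    chartEval e p (j.coord p a • s) = frac p a 1 p.one_notMem • chartEval e p s := by
  rw [chartEval_smul, j.comap_coord]
  rfl

theorem res_chartSection {p q : MSpec A} (h : q.asIdeal ⊆ p.asIdeal) (m : M.carrier) :
    F.res (homOfLE (j.nbhd_le_nbhd h)) (chartSection e p m) = chartSection e q m := by
  apply (e.equiv _ (j.nbhd_subset_range q)).injective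
  rw [e.equiv_res (j.nbhd_subset_range p) (j.nbhd_subset_range q), equiv_chartSection,
    equiv_chartSection]
  rfl

theorem coord_smul_eq_chartSection {p : MSpec A} {s : F.Γ (j.nbhd p)} {m : M.carrier} {f : A}
    {hf : f ∉ p.asIdeal} (h : chartEval e p s = frac p m f hf) :
    j.coord p f • s = chartSection e p m := by
  apply chartEval_injective e p
  rw [chartEval_coord_smul, chartEval_chartSection, h, frac_smul_frac, frac_eq_iff]
  refine ⟨1, p.one_notMem, ?_⟩
  rw [one_smul, one_smul, one_smul, one_mul]

theorem coord_smul_chartSection (p : MSpec A) (a : A) (m : M.carrier) :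
    j.coord p a • chartSection e p m = chartSection e p (a • m) := by
  apply chartEval_injective e p
  rw [chartEval_coord_smul, chartEval_chartSection, chartEval_chartSection, frac_smul_frac]
  congr 1
  exact one_mul 1

theorem exists_coord_smul_eq (p : MSpec A) (s : F.Γ (j.nbhd p)) :
    ∃ f ∉ p.asIdeal, ∃ m, j.coord p f • s = chartSection e p m := by
  obtain ⟨m, f, hf, h⟩ := exists_frac p (chartEval e p s)
  exact ⟨f, hf, m, coord_smul_eq_chartSection e h⟩

theorem exists_smul_eq_of_chartSection_eq {p : MSpec A} {m m' : M.carrier}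
    (h : chartSection e p m = chartSection e p m') : ∃ u ∉ p.asIdeal, u • m = u • m' := by
  have h' := congrArg (chartEval e p) h
  rw [chartEval_chartSection, chartEval_chartSection, frac_eq_iff] at h'
  obtain ⟨u, hu, e⟩ := h'
  exact ⟨u, hu, by rwa [one_smul, one_smul] at e⟩

theorem exists_resHom_smul_eq (e : j.RestrictionIso F (tildeObj M)) {p q : MSpec A}
    (hq : q.asIdeal ⊆ p.asIdeal)
    (t : F.Γ (j.nbhd q)) : ∃ a : X.Γ (j.nbhd p),
      IsUnit (X.resHom (homOfLE (j.nbhd_le_nbhd hq)) a) ∧ ∃ s : F.Γ (j.nbhd p),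
        X.resHom (homOfLE (j.nbhd_le_nbhd hq)) a • t =
          F.res (homOfLE (j.nbhd_le_nbhd hq)) s := by
  obtain ⟨f, hf, m, h⟩ := exists_coord_smul_eq e q t
  refine ⟨j.coord p f, ?_, chartSection e p m, ?_⟩
  · rw [j.resHom_coord hq]
    exact (j.isUnit_coord_iff f).2 hf
  · rw [j.resHom_coord hq, h, res_chartSection e hq]

theorem exists_isUnit_smul_eq_smul (e : j.RestrictionIso F (tildeObj M)) {p q : MSpec A}
    (hq : q.asIdeal ⊆ p.asIdeal)
    (s s' : F.Γ (j.nbhd p)) (hs : F.res (homOfLE (j.nbhd_le_nbhd hq)) s =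
      F.res (homOfLE (j.nbhd_le_nbhd hq)) s') : ∃ a : X.Γ (j.nbhd p),
      IsUnit (X.resHom (homOfLE (j.nbhd_le_nbhd hq)) a) ∧ a • s = a • s' := by
  obtain ⟨f, hf, m, h₁⟩ := exists_coord_smul_eq e p s
  obtain ⟨f', hf', m', h₂⟩ := exists_coord_smul_eq e p s'
  have key : chartSection e q (f' • m) = chartSection e q (f • m') := by
    rw [← coord_smul_chartSection, ← coord_smul_chartSection, ← res_chartSection e hq,
      ← res_chartSection e hq, ← h₁, ← h₂, res_smul_resHom, res_smul_resHom,
      j.resHom_coord hq, j.resHom_coord hq, hs]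
    exact smul_comm _ _ _
  obtain ⟨u, hu, hh⟩ := exists_smul_eq_of_chartSection_eq e key
  refine ⟨j.coord p (u * (f' * f)), ?_, ?_⟩
  · rw [j.resHom_coord hq, j.isUnit_coord_iff]
    exact mul_notMem hu (mul_notMem (fun h => hf' (hq h)) fun h => hf (hq h))
  · have h₁' : j.coord p (u * (f' * f)) • s = chartSection e p (u • f' • m) := by
      rw [map_mul, map_mul, mul_smul, mul_smul, h₁, coord_smul_chartSection,
        coord_smul_chartSection]
    rw [h₁', hh, mul_comm f', map_mul, map_mul, mul_smul, mul_smul, h₂, coord_smul_chartSection,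
      coord_smul_chartSection]

theorem isFGAction_of_restrictionIso (e : j.RestrictionIso F (tildeObj M))
    (hM : AMod.isFG A M) (p : MSpec A) :
    IsFGAction (X.Γ (j.nbhd p)) (F.Γ (j.nbhd p)) := by
  obtain ⟨S, hS, hgen⟩ := hM
  refine ⟨chartSection e p '' S, hS.image _, fun s => ?_⟩
  obtain ⟨f, hf, m, h⟩ := exists_coord_smul_eq e p s
  obtain ⟨a, g, hg, rfl⟩ := hgen m
  obtain ⟨b, hb⟩ := ((j.isUnit_coord_iff f).2 hf).exists_left_inv
  refine ⟨b * j.coord p a, chartSection e p g, ⟨g, hg, rfl⟩, ?_⟩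
  rw [mul_smul, coord_smul_chartSection, ← h, ← mul_smul, hb, one_smul]

end RestrictionIso

theorem isQuasicoherent_of_isCoherent {X : MonoidalSpace.{u}} {F : OMod X}
    (hF : isCoherent X F) : isQuasicoherent X F := fun x => by
  obtain ⟨c, hx, M, -, e⟩ := hF x
  exact ⟨c, hx, M, e⟩

theorem IsLocalizing.of_isQuasicoherent {F : OMod X} (hF : isQuasicoherent X F) :
    IsLocalizing F where
  exists_smul_eq {x y} h t := by
    obtain ⟨c, ⟨p, rfl⟩, M, ⟨e⟩⟩ := hF x
    obtain ⟨q, rfl, hq⟩ := c.immersion.exists_pt_of_le (p := p) h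
    exact exists_resHom_smul_eq e hq t
  exists_smul_eq_smul {x y} h s s' hs := by
    obtain ⟨c, ⟨p, rfl⟩, M, ⟨e⟩⟩ := hF x
    obtain ⟨q, rfl, hq⟩ := c.immersion.exists_pt_of_le (p := p) h
    exact exists_isUnit_smul_eq_smul e hq s s' hs

theorem HasFGStalks.of_isCoherent {F : OMod X} (hF : isCoherent X F) : HasFGStalks F := by
  intro x
  obtain ⟨c, ⟨p, rfl⟩, M, hM, ⟨e⟩⟩ := hF x
  exact isFGAction_of_restrictionIso e hM p

end OMod

namespace OpenImmersion

open MSpec MonoidalSpace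

variable {X : MonoidalSpace.{u}} [AlexandrovDiscrete X.carrier] {A : Type u}
  [CommMonoidWithZero A] (j : OpenImmersion (mSpec A) X)

theorem exists_coord_smul_eq (p : MSpec A) {f : A} (hf : f ∉ p.asIdeal) {F : OMod X}
    (s : F.Γ (j.nbhd p)) :
    ∃ t : F.Γ (j.nbhd p), j.coord p f • t = s := by
  obtain ⟨b, hb⟩ := ((j.isUnit_coord_iff f).2 hf).exists_right_inv
  exact ⟨b • s, by rw [← mul_smul, hb, one_smul]⟩

section Nontrivial

variable [Nontrivial A]

theorem coord_closedPoint_surjective : Function.Surjective (j.coord (closedPoint A)) := by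
  intro a
  obtain ⟨b, g, hg, e⟩ := j.exists_mul_coord_eq (closedPoint A) a
  have hg' : IsUnit g := not_not.1 ((j.isUnit_coord_iff g).1 hg)
  obtain ⟨h, hh⟩ := hg'.exists_right_inv
  refine ⟨b * h, ?_⟩
  rw [map_mul, ← e, mul_assoc, ← map_mul, hh, map_one, mul_one]

/-- The module of sections of a sheaf over a chart. -/
def chartModule (F : OMod X) : AMod A where
  carrier := F.Γ (j.nbhd (closedPoint A))
  zero := inferInstance
  action := MulActionWithZero.compHom (F.Γ (j.nbhd (closedPoint A))) (j.coord (closedPoint A))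

variable {j} {F : OMod X}

/-- Restriction from the chart to the stalk. -/
def chartRes (p : MSpec A) (s : (j.chartModule F).carrier) : F.Γ (j.nbhd p) :=
  F.res (homOfLE (j.nbhd_le_nbhd (le_closedPoint p))) s

theorem chartRes_smul (p : MSpec A) (a : A) (s : (j.chartModule F).carrier) :
    chartRes p (a • s) = j.coord p a • chartRes p s := by
  rw [← j.resHom_coord (le_closedPoint p) a]
  exact F.res_smul_resHom _ _ _

theorem chartRes_zero (p : MSpec A) : chartRes p (0 : (j.chartModule F).carrier) = 0 :=
  F.res_zero_eq _

theorem res_chartRes {p q : MSpec A} (h : q.asIdeal ⊆ p.asIdeal)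
    (s : (j.chartModule F).carrier) :
    F.res (homOfLE (j.nbhd_le_nbhd h)) (chartRes p s) = chartRes q s :=
  F.res_res _ _ _ s

theorem exists_coord_smul_eq_chartRes (hF : F.IsLocalizing) (p : MSpec A) (t : F.Γ (j.nbhd p)) :
    ∃ f ∉ p.asIdeal, ∃ s : (j.chartModule F).carrier, j.coord p f • t = chartRes p s := by
  obtain ⟨a, ha, s, h⟩ := hF.exists_smul_eq (j.nbhd_le_nbhd (le_closedPoint p)) t
  obtain ⟨f, rfl⟩ := j.coord_closedPoint_surjective a
  have hf := j.resHom_coord (le_closedPoint p) f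
  refine ⟨f, (j.isUnit_coord_iff f).1 (hf ▸ ha), s, ?_⟩
  rw [← hf]
  exact h

theorem exists_smul_eq_smul_of_chartRes_eq (hF : F.IsLocalizing) {p : MSpec A}
    {s s' : (j.chartModule F).carrier} (h : chartRes p s = chartRes p s') :
    ∃ u ∉ p.asIdeal, u • s = u • s' := by
  obtain ⟨a, ha, h⟩ := hF.exists_smul_eq_smul (j.nbhd_le_nbhd (le_closedPoint p)) s s' h
  obtain ⟨f, rfl⟩ := j.coord_closedPoint_surjective a
  have hf := j.resHom_coord (le_closedPoint p) f
  exact ⟨f, (j.isUnit_coord_iff f).1 (hf ▸ ha), h⟩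

/-- An element of a stalk as a fraction. -/
def toFrac (hF : F.IsLocalizing) (p : MSpec A) (t : F.Γ (j.nbhd p)) :
    localizationAt A (j.chartModule F).carrier p :=
  frac p (exists_coord_smul_eq_chartRes hF p t).choose_spec.2.choose
    (exists_coord_smul_eq_chartRes hF p t).choose
    (exists_coord_smul_eq_chartRes hF p t).choose_spec.1

theorem frac_eq_frac_iff (hF : F.IsLocalizing) {p : MSpec A} {t t' : F.Γ (j.nbhd p)} {f f' : A}
    (hf : f ∉ p.asIdeal) (hf' : f' ∉ p.asIdeal) {s s' : (j.chartModule F).carrier}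
    (h : j.coord p f • t = chartRes p s) (h' : j.coord p f' • t' = chartRes p s') :
    frac p s f hf = frac p s' f' hf' ↔ t = t' := by
  have e : chartRes p (f' • s) = j.coord p (f' * f) • t := by
    rw [chartRes_smul, ← h, map_mul, mul_smul]
  have e' : chartRes p (f • s') = j.coord p (f' * f) • t' := by
    rw [chartRes_smul, ← h', mul_comm, map_mul, mul_smul]
  rw [frac_eq_iff]
  constructor
  · rintro ⟨u, hu, hh⟩
    have key := congrArg (chartRes p) hh
    rw [chartRes_smul, chartRes_smul p u (f • s')] at key
    have := ((j.isUnit_coord_iff u).2 hu).smul_cancel_mulAction key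
    rw [e, e'] at this
    exact ((j.isUnit_coord_iff _).2 (mul_notMem hf' hf)).smul_cancel_mulAction this
  · rintro rfl
    exact exists_smul_eq_smul_of_chartRes_eq hF (e.trans e'.symm)

theorem toFrac_eq (hF : F.IsLocalizing) {p : MSpec A} {t : F.Γ (j.nbhd p)} {f : A}
    (hf : f ∉ p.asIdeal) {s : (j.chartModule F).carrier}
    (h : j.coord p f • t = chartRes p s) : toFrac hF p t = frac p s f hf :=
  (frac_eq_frac_iff hF _ hf (exists_coord_smul_eq_chartRes hF p t).choose_spec.2.choose_spec
    h).2 rfl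

theorem toFrac_injective (hF : F.IsLocalizing) (p : MSpec A) :
    Function.Injective (toFrac (j := j) hF p) := by
  intro t t' h
  obtain ⟨f, hf, s, e⟩ := exists_coord_smul_eq_chartRes hF p t
  obtain ⟨f', hf', s', e'⟩ := exists_coord_smul_eq_chartRes hF p t'
  rw [toFrac_eq hF hf e, toFrac_eq hF hf' e'] at h
  exact (frac_eq_frac_iff hF hf hf' e e').1 h

theorem toFrac_zero (hF : F.IsLocalizing) (p : MSpec A) :
    toFrac hF p (0 : F.Γ (j.nbhd p)) = 0 := by
  rw [toFrac_eq hF p.one_notMem (s := 0) (by rw [chartRes_zero, smul_zero]), frac_zero]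

theorem toFrac_smul (hF : F.IsLocalizing) (p : MSpec A) (a : X.Γ (j.nbhd p))
    (t : F.Γ (j.nbhd p)) : toFrac hF p (a • t) =
      mSpecEval (j.comap _ a) p (j.mem_preimage_nbhd p) • toFrac hF p t := by
  obtain ⟨f, hf, s, e⟩ := exists_coord_smul_eq_chartRes hF p t
  obtain ⟨b, g, hg, h⟩ := exists_frac p (mSpecEval (j.comap _ a) p (j.mem_preimage_nbhd p))
  rw [h, toFrac_eq hF hf e, frac_smul_frac]
  refine toFrac_eq hF _ ?_
  rw [chartRes_smul, ← e, ← j.mul_coord_eq h, map_mul, ← mul_smul, ← mul_smul]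
  congr 1
  rw [mul_comm, mul_assoc]

theorem toFrac_res (hF : F.IsLocalizing) {p : MSpec A} (t : F.Γ (j.nbhd p)) :
    ∃ (s : (j.chartModule F).carrier) (f : A), ∀ q (h : q.asIdeal ⊆ p.asIdeal), ∃ hf,
      toFrac hF q (F.res (homOfLE (j.nbhd_le_nbhd h)) t) = frac q s f hf := by
  obtain ⟨f, hf, s, e⟩ := exists_coord_smul_eq_chartRes hF p t
  refine ⟨s, f, fun q h => ⟨fun hf' => hf (h hf'), toFrac_eq hF _ ?_⟩⟩
  rw [← res_chartRes h, ← e, F.res_smul_resHom, j.resHom_coord h]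

theorem exists_toFrac_section (hF : F.IsLocalizing) {V : Opens X.carrier} (s : F.Γ V) :
    ∃ σ : (tildeObj (j.chartModule F)).Γ ((Opens.map j.map).obj V), ∀ (p : MSpec A)
      (hp : p ∈ (Opens.map j.map).obj V),
      tildeEval σ p hp = toFrac hF p (F.res (homOfLE (j.nbhd_le_iff.2 hp)) s) := by
  refine exists_tildeEval_eq _ fun p hp => ?_
  obtain ⟨m, f, h⟩ := toFrac_res hF (F.res (homOfLE (j.nbhd_le_iff.2 hp)) s)
  refine ⟨(Opens.map j.map).obj (j.nbhd p), j.mem_preimage_nbhd p, m, f, fun q hq hqp => ?_⟩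
  obtain ⟨hf, e⟩ := h q (j.le_of_mem_preimage_nbhd hqp)
  exact ⟨hf, by rw [← e, F.res_res]⟩

/-- The map from sections of `F` to sections of `M~`. -/
def toTilde (hF : F.IsLocalizing) {V : Opens X.carrier} (s : F.Γ V) :
    (tildeObj (j.chartModule F)).Γ ((Opens.map j.map).obj V) :=
  (exists_toFrac_section hF s).choose

theorem tildeEval_toTilde (hF : F.IsLocalizing) {V : Opens X.carrier} (s : F.Γ V) (p : MSpec A)
    (hp : p ∈ (Opens.map j.map).obj V) : tildeEval (toTilde hF s) p hp =
      toFrac hF p (F.res (homOfLE (j.nbhd_le_iff.2 hp)) s) :=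
  (exists_toFrac_section hF s).choose_spec p hp

theorem toTilde_bijective (hF : F.IsLocalizing) {V : Opens X.carrier}
    (hV : (V : Set X.carrier) ⊆ Set.range j.map) :
    Function.Bijective (toTilde (j := j) (V := V) hF) := by
  constructor
  · intro s t h
    refine F.eq_of_res_core_eq fun x hx => ?_
    obtain ⟨p, rfl⟩ := j.exists_eq_pt_of_mem (hV hx)
    apply toFrac_injective (j := j) hF p
    refine (tildeEval_toTilde hF s p hx).symm.trans ?_
    rw [h]
    exact tildeEval_toTilde hF t p hx
  · intro σ
    have key (p : MSpec A) (hp : p ∈ (Opens.map j.map).obj V) :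
        ∃ t : F.Γ (j.nbhd p), ∀ (q : MSpec A) (h : q.asIdeal ⊆ p.asIdeal),
          toFrac hF q (F.res (homOfLE (j.nbhd_le_nbhd h)) t) =
            tildeEval σ q (mem_of_le h hp) := by
      obtain ⟨m, f, h⟩ := exists_tildeEval_eq_frac σ hp
      obtain ⟨hf, e⟩ := h p subset_rfl
      obtain ⟨t, ht⟩ := j.exists_coord_smul_eq p hf (chartRes p m)
      refine ⟨t, fun q hq => ?_⟩
      obtain ⟨hfq, eq⟩ := h q hq
      rw [eq]
      refine toFrac_eq hF hfq ?_
      rw [← res_chartRes hq, ← ht, F.res_smul_resHom, j.resHom_coord hq]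
    choose t ht using key
    obtain ⟨s, hs⟩ := F.exists_glue (V := V)
      (fun p : {p : MSpec A // p ∈ (Opens.map j.map).obj V} => j.pt p.1) (fun p => p.2)
      (fun x hx => by
        obtain ⟨p, rfl⟩ := j.exists_eq_pt_of_mem (hV hx)
        exact ⟨⟨p, hx⟩, rfl⟩) (fun p => t p.1 p.2) (fun p q h => by
        have hqp : q.1.asIdeal ⊆ p.1.asIdeal := j.pt_mem_nbhd_iff.1 (j.nbhd_le_iff.1 h)
        apply toFrac_injective (j := j) hF q.1
        refine (ht p.1 p.2 q.1 hqp).trans ?_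
        rw [← ht q.1 q.2 q.1 subset_rfl, F.res_self])
    refine ⟨s, tildeEval_ext fun p hp => ?_⟩
    rw [tildeEval_toTilde, ← ht p hp p subset_rfl, F.res_self]
    exact congrArg _ (hs ⟨p, hp⟩)

/-- In a chart, a sheaf whose stalks are localizations comes from a module. -/
def restrictionIsoChartModule (hF : F.IsLocalizing) :
    j.RestrictionIso F (tildeObj (j.chartModule F)) where
  equiv V hV := Equiv.ofBijective (toTilde hF) (toTilde_bijective hF hV)
  map_zero V hV := tildeEval_ext fun p hp => by
    refine (tildeEval_toTilde hF _ p hp).trans ?_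
    rw [F.res_zero_eq, toFrac_zero, tildeEval_zero]
  map_smul V hV a s := tildeEval_ext fun p hp => by
    refine (tildeEval_toTilde hF _ p hp).trans ?_
    rw [F.res_smul_resHom, toFrac_smul, j.comap_resHom, tildeEval_smul]
    exact congrArg _ (tildeEval_toTilde hF s p hp).symm
  equiv_res {V W} hV hW i s := tildeEval_ext fun p hp => by
    refine (tildeEval_toTilde hF _ p hp).trans ?_
    rw [tildeEval_res, F.res_res _ _ (homOfLE (j.nbhd_le_iff.2 (i.le hp)))]
    exact (tildeEval_toTilde hF s p _).symm

theorem isFG_chartModule (hF : F.HasFGStalks) : AMod.isFG A (j.chartModule F) := by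
  obtain ⟨s, hs, h⟩ := hF (j.pt (closedPoint A))
  refine ⟨s, hs, fun m => ?_⟩
  obtain ⟨a, g, hg, e⟩ := h m
  obtain ⟨b, rfl⟩ := j.coord_closedPoint_surjective a
  exact ⟨b, g, hg, e⟩

end Nontrivial

/-- Over the empty chart all sheaves are isomorphic. -/
def restrictionIsoOfSubsingleton [Subsingleton A] (F : OMod X) (M : AMod A) :
    j.RestrictionIso F (tildeObj M) where
  equiv V hV :=
    { toFun := fun _ => 0
      invFun := fun _ => 0
      left_inv := fun s => F.eq_of_res_core_eq fun x hx => by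
        obtain ⟨p, rfl⟩ := hV hx
        exact (not_subsingleton_iff_nontrivial.2 (MSpec.nontrivial p) inferInstance).elim
      right_inv := fun s => tildeEval_ext fun p hp =>
        (not_subsingleton_iff_nontrivial.2 (MSpec.nontrivial p) inferInstance).elim }
  map_zero V hV := rfl
  map_smul V hV a s := (smul_zero (A := (tildeObj M).Γ _) _).symm
  equiv_res hV hW i s := ((tildeObj M).res_zero_eq _).symm

theorem exists_restrictionIso {F : OMod X} (hF : F.IsLocalizing) :
    ∃ M : AMod A, Nonempty (j.RestrictionIso F (tildeObj M)) ∧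
      (F.HasFGStalks → AMod.isFG A M) := by
  rcases subsingleton_or_nontrivial A with h | h
  · have hM (m : PUnit.{u + 1}) : m = PUnit.unit := rfl
    let M : AMod A :=
      { carrier := A
        zero := inferInstance
        action := inferInstance }
    exact ⟨M, ⟨j.restrictionIsoOfSubsingleton F M⟩, fun _ => ⟨{1}, Set.finite_singleton _,
      fun m => ⟨m, 1, rfl, (mul_one m).symm⟩⟩⟩
  · exact ⟨j.chartModule F, ⟨restrictionIsoChartModule hF⟩, isFG_chartModule⟩

end OpenImmersion

namespace OMod

open MonoidalSpace

variable {X : MonoidalSpace.{u}} [AlexandrovDiscrete X.carrier]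

theorem isQuasicoherent_iff (hX : X.IsMonoidScheme) (F : OMod X) :
    isQuasicoherent X F ↔ F.IsLocalizing := by
  refine ⟨.of_isQuasicoherent, fun hF x => ?_⟩
  obtain ⟨c, hc⟩ := hX x
  obtain ⟨M, e, -⟩ := c.immersion.exists_restrictionIso hF
  exact ⟨c, hc, M, e⟩

theorem isCoherent_iff (hX : X.IsMonoidScheme) (F : OMod X) :
    isCoherent X F ↔ F.IsLocalizing ∧ F.HasFGStalks := by
  refine ⟨fun h => ⟨.of_isQuasicoherent (isQuasicoherent_of_isCoherent h), .of_isCoherent h⟩,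
    fun hF x => ?_⟩
  obtain ⟨c, hc⟩ := hX x
  obtain ⟨M, e, hM⟩ := c.immersion.exists_restrictionIso hF.1
  exact ⟨c, hc, M, hM hF.2, e⟩

end OMod

namespace OMod

open MonoidalSpace

variable {X : MonoidalSpace.{u}}

/-- A class of sheaves that contains the zero sheaves and is closed under admissible subobjects
and quotients. -/
structure IsSerre (P : ObjectProperty (OMod X)) : Prop where
  of_isZero {F : OMod X} : IsZero F → P F
  of_admMono {F G : OMod X} (f : F ⟶ G) : admMono X f → P G → P F
  of_admEpi {F G : OMod X} (f : F ⟶ G) : admEpi X f → P F → P G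

theorem isSerre_top : IsSerre (⊤ : ObjectProperty (OMod X)) :=
  ⟨fun _ => trivial, fun _ _ _ => trivial, fun _ _ _ => trivial⟩

theorem IsSerre.inf {P Q : ObjectProperty (OMod X)} (hP : IsSerre P) (hQ : IsSerre Q) :
    IsSerre (P ⊓ Q) :=
  ⟨fun h => ⟨hP.of_isZero h, hQ.of_isZero h⟩,
    fun f hf h => ⟨hP.of_admMono f hf h.1, hQ.of_admMono f hf h.2⟩,
    fun f hf h => ⟨hP.of_admEpi f hf h.1, hQ.of_admEpi f hf h.2⟩⟩

variable [AlexandrovDiscrete X.carrier]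

theorem IsLocalizing.of_isZero {F : OMod X} (h : IsZero F) : IsLocalizing F where
  exists_smul_eq _ _ := ⟨1, by rw [map_one]; exact isUnit_one, 0,
    (eq_zero_of_isZero h _).trans (eq_zero_of_isZero h _).symm⟩
  exists_smul_eq_smul _ _ _ _ := ⟨1, by rw [map_one]; exact isUnit_one,
    (eq_zero_of_isZero h _).trans (eq_zero_of_isZero h _).symm⟩

theorem HasFGStalks.of_isZero {F : OMod X} (h : IsZero F) : HasFGStalks F :=
  fun _ => ⟨{0}, Set.finite_singleton _, fun _ => ⟨1, 0, rfl,
    (eq_zero_of_isZero h _).trans (eq_zero_of_isZero h _).symm⟩⟩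

section Square

variable {A B A' B' : OMod X} {i : A ⟶ B} {j : A ⟶ A'} {j' : B ⟶ B'} {i' : A' ⟶ B'}

theorem IsLocalizing.of_isPullback (hi : admMono X i) (hi' : admMono X i') (hj' : admEpi X j')
    (h : IsPullback i j j' i') (hB : B.IsLocalizing) (hA' : A'.IsLocalizing)
    (hB' : B'.IsLocalizing) : A.IsLocalizing := by
  have hinj (x) := (stalkMap_injective_iff i x).1 (hi x)
  have hw (x) (a) : app j' (Opens.core x) (app i _ a) = app i' _ (app j _ a) :=
    congrArg (fun f => app f (Opens.core x) a) h.w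
  constructor
  · intro x y hxy t
    obtain ⟨a, ha, s, hs⟩ := hB.exists_smul_eq hxy (app i _ t)
    obtain ⟨b, hb, s', hs'⟩ := hA'.exists_smul_eq hxy (app j _ t)
    obtain ⟨c, hc, e⟩ := hB'.exists_smul_eq_smul hxy (b • app j' _ s) (a • app i' _ s') (by
      rw [res_smul_resHom, res_smul_resHom, ← app_res, ← app_res, ← hs, ← hs', app_smul,
        app_smul, hw, smul_comm])
    obtain ⟨r, hr⟩ := exists_app_eq_of_isPullback hi' hj' h x (c • b • s) (c • a • s') (by
      rw [app_smul, app_smul, app_smul, app_smul, e])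
    refine ⟨c * b * a, ?_, r, hinj y ?_⟩
    · rw [map_mul, map_mul]
      exact (hc.mul hb).mul ha
    · rw [app_smul, app_res, hr, res_smul_resHom, res_smul_resHom, ← hs, map_mul, map_mul,
        mul_smul, mul_smul]
  · intro x y hxy s s' hs
    obtain ⟨a, ha, e⟩ := hB.exists_smul_eq_smul hxy (app i _ s) (app i _ s') (by
      rw [← app_res, hs, app_res])
    exact ⟨a, ha, hinj x (by rw [app_smul, app_smul, e])⟩

theorem IsLocalizing.of_isPushout (hi' : admMono X i') (hj' : admEpi X j')
    (h : IsPullback i j j' i') (hA : A.IsLocalizing) (hB : B.IsLocalizing)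
    (hA' : A'.IsLocalizing) : B'.IsLocalizing := by
  have hinj' (x) := (stalkMap_injective_iff i' x).1 (hi' x)
  have hsurj (x) := (stalkMap_isAdmissibleSurjection_iff j' x).1 (hj' x)
  have hw (x) (a) : app j' (Opens.core x) (app i _ a) = app i' _ (app j _ a) :=
    congrArg (fun f => app f (Opens.core x) a) h.w
  have hzero {x y : X.carrier} (hxy : Opens.core y ≤ Opens.core x) (b : B.Γ (Opens.core x))
      (hb : app j' _ (B.res (homOfLE hxy) b) = 0) : ∃ a : X.Γ (Opens.core x),
        IsUnit (X.resHom (homOfLE hxy) a) ∧ a • app j' _ b = 0 := by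
    obtain ⟨α, hα⟩ := exists_app_eq_of_isPullback hi' hj' h y (B.res (homOfLE hxy) b) 0 (by
      rw [hb, app_zero])
    have hjα : app j _ α = 0 := hinj' y (by rw [← hw, hα, hb, app_zero])
    obtain ⟨c, hc, α', hα'⟩ := hA.exists_smul_eq hxy α
    obtain ⟨d, hd, e⟩ := hA'.exists_smul_eq_smul hxy (app j _ α') 0 (by
      rw [← app_res, ← hα', app_smul, hjα, smul_zero, res_zero_eq])
    obtain ⟨r, hr, e'⟩ := hB.exists_smul_eq_smul hxy (app i _ α') (c • b) (by
      rw [← app_res, ← hα', app_smul, hα, res_smul_resHom])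
    refine ⟨d * (r * c), ?_, ?_⟩
    · rw [map_mul, map_mul]
      exact hd.mul (hr.mul hc)
    · rw [mul_smul, mul_smul, ← app_smul, ← app_smul, ← e', app_smul, hw, smul_comm, ← app_smul,
        e, smul_zero, app_zero, smul_zero]
  constructor
  · intro x y hxy t
    obtain ⟨b, rfl⟩ := (hsurj y).1 t
    obtain ⟨a, ha, s, hs⟩ := hB.exists_smul_eq hxy b
    exact ⟨a, ha, app j' _ s, by rw [← app_smul, hs, app_res]⟩
  · intro x y hxy s s' hs
    obtain ⟨b, rfl⟩ := (hsurj x).1 s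
    obtain ⟨b', rfl⟩ := (hsurj x).1 s'
    rw [← app_res, ← app_res] at hs
    by_cases h0 : app j' _ (B.res (homOfLE hxy) b) = 0
    · obtain ⟨a, ha, e⟩ := hzero hxy b h0
      obtain ⟨a', ha', e'⟩ := hzero hxy b' (hs ▸ h0)
      refine ⟨a * a', ?_, ?_⟩
      · rw [map_mul]
        exact ha.mul ha'
      · rw [mul_smul a a' (app j' _ b'), e', mul_comm, mul_smul, e, smul_zero, smul_zero]
    · have hbb := (hsurj y).2 h0 (show app j' _ _ ≠ 0 from hs ▸ h0) hs
      obtain ⟨a, ha, e⟩ := hB.exists_smul_eq_smul hxy b b' hbb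
      exact ⟨a, ha, by rw [← app_smul, ← app_smul, e]⟩

theorem HasFGStalks.of_admMono (hX : X.IsFiniteType) (hi : admMono X i) (hB : B.HasFGStalks) :
    A.HasFGStalks := fun x =>
  (hB x).of_injective (hX.isNoetherianMonoid x) (app i _) (app_smul i _)
    ((stalkMap_injective_iff i x).1 (hi x))

theorem HasFGStalks.of_admEpi (hj' : admEpi X j') (hB : B.HasFGStalks) : B'.HasFGStalks :=
  fun x => (hB x).of_surjective (app j' _) (app_smul j' _)
    ((stalkMap_isAdmissibleSurjection_iff j' x).1 (hj' x)).1

end Square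

theorem isAdmissiblyClosed_isQuasicoherent_inf (hX : X.IsMonoidScheme) {P : ObjectProperty (OMod X)}
    (hP : IsSerre P) :
    IsAdmissiblyClosed (admMono X) (admEpi X) (isQuasicoherent X ⊓ P).ι where
  zero O hO := ⟨⟨O, (isQuasicoherent_iff hX O).2 (.of_isZero hO), hP.of_isZero hO⟩,
    ⟨Iso.refl _⟩⟩
  pullback A B A' B' i _ _ _ hi hi' _ hj' h _ := ⟨⟨A, (isQuasicoherent_iff hX A).2
      (.of_isPullback hi hi' hj' h ((isQuasicoherent_iff hX _).1 B.2.1)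
        ((isQuasicoherent_iff hX _).1 A'.2.1) ((isQuasicoherent_iff hX _).1 B'.2.1)),
    hP.of_admMono i hi B.2.2⟩, ⟨Iso.refl _⟩⟩
  pushout A B A' B' _ _ j' _ _ hi' _ hj' h _ := ⟨⟨B', (isQuasicoherent_iff hX B').2
      (.of_isPushout hi' hj' h ((isQuasicoherent_iff hX _).1 A.2.1)
        ((isQuasicoherent_iff hX _).1 B.2.1) ((isQuasicoherent_iff hX _).1 A'.2.1)),
    hP.of_admEpi j' hj' B.2.2⟩, ⟨Iso.refl _⟩⟩

theorem isSerre_hasFGStalks (hX : X.IsFiniteType) :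
    IsSerre (HasFGStalks : ObjectProperty (OMod X)) :=
  ⟨.of_isZero, fun _ hf h => .of_admMono hX hf h, fun _ hf h => .of_admEpi hf h⟩

theorem isSupportedIn_iff (Z : Set X.carrier) (F : OMod X) :
    isSupportedIn Z F ↔ ∀ x ∉ Z, ∀ s : F.Γ (Opens.core x), s = 0 := by
  refine forall_congr' fun x => ?_
  rw [mem_support_iff, ← not_imp_not, not_exists]
  simp only [not_not]

theorem isSerre_isSupportedIn (Z : Set X.carrier) : IsSerre (X := X) (isSupportedIn Z) where
  of_isZero h := (isSupportedIn_iff Z _).2 fun _ _ => eq_zero_of_isZero h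
  of_admMono f hf h := (isSupportedIn_iff Z _).2 fun x hx s =>
    (stalkMap_injective_iff f x).1 (hf x) (((isSupportedIn_iff Z _).1 h x hx _).trans
      (app_zero f _).symm)
  of_admEpi f hf h := (isSupportedIn_iff Z _).2 fun x hx s => by
    obtain ⟨t, rfl⟩ := ((stalkMap_isAdmissibleSurjection_iff f x).1 (hf x)).1 s
    rw [(isSupportedIn_iff Z _).1 h x hx t, app_zero]

theorem isAnnihilatedBy_iff (I : IdealSheaf X) (F : OMod X) : isAnnihilatedBy I F ↔
    ∀ x, ∀ a ∈ I.ideal (Opens.core x), ∀ s : F.Γ (Opens.core x), a • s = 0 := by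
  refine ⟨fun h x => h _, fun h U a ha s => F.eq_of_res_core_eq fun x hx => ?_⟩
  rw [res_zero_eq, res_smul_resHom]
  obtain ⟨b, rfl⟩ := ha
  exact h x _ ⟨_, app_res I.incl _ b⟩ _

theorem isSerre_isAnnihilatedBy (I : IdealSheaf X) : IsSerre (isAnnihilatedBy I) where
  of_isZero h := (isAnnihilatedBy_iff I _).2 fun _ _ _ _ => eq_zero_of_isZero h _
  of_admMono f hf h := (isAnnihilatedBy_iff I _).2 fun x a ha s =>
    (stalkMap_injective_iff f x).1 (hf x) (by
      rw [app_smul, (isAnnihilatedBy_iff I _).1 h x a ha, app_zero])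
  of_admEpi f hf h := (isAnnihilatedBy_iff I _).2 fun x a ha s => by
    obtain ⟨t, rfl⟩ := ((stalkMap_isAdmissibleSurjection_iff f x).1 (hf x)).1 s
    rw [← app_smul, (isAnnihilatedBy_iff I _).1 h x a ha, app_zero]

theorem isCoherent_eq (hX : X.IsMonoidScheme) :
    isCoherent X = isQuasicoherent X ⊓ (HasFGStalks : ObjectProperty (OMod X)) := by
  ext F
  rw [isCoherent_iff hX F, ← isQuasicoherent_iff hX F]
  rfl

/-- Coherent sheaves in a Serre class. -/
theorem isAdmissiblyClosed_isCoherent_inf (hX : X.IsMonoidScheme) (hX' : X.IsFiniteType)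
    {P : ObjectProperty (OMod X)} (hP : IsSerre P) :
    IsAdmissiblyClosed (admMono X) (admEpi X) (isCoherent X ⊓ P).ι := by
  rw [isCoherent_eq hX, inf_assoc]
  exact isAdmissiblyClosed_isQuasicoherent_inf hX ((isSerre_hasFGStalks hX').inf hP)

theorem isAdmissiblyClosed_isQuasicoherent (hX : X.IsMonoidScheme) :
    IsAdmissiblyClosed (admMono X) (admEpi X) (isQuasicoherent X).ι := by
  rw [← inf_top_eq (isQuasicoherent X)]
  exact isAdmissiblyClosed_isQuasicoherent_inf hX isSerre_top

theorem isAdmissiblyClosed_isCoherent (hX : X.IsMonoidScheme) (hX' : X.IsFiniteType) :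
    IsAdmissiblyClosed (admMono X) (admEpi X) (isCoherent X).ι := by
  rw [isCoherent_eq hX]
  exact isAdmissiblyClosed_isQuasicoherent_inf hX (isSerre_hasFGStalks hX')

theorem isProtoExactSubcategory {P : ObjectProperty (OMod X)}
    (hP : IsAdmissiblyClosed (admMono X) (admEpi X) P.ι) : IsProtoExactSubcategory P :=
  (isProtoExact X).inverseImage hP

end OMod

/-! ## The functor `M ↦ M~` -/

section TildeEquivalence

open MSpec MonoidalSpace

variable {A : Type u} [CommMonoidWithZero A]

namespace MSpec

variable {M N : Type u} [Zero M] [MulActionWithZero A M] [Zero N] [MulActionWithZero A N]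

theorem mapActionHom_injective {φ : M →[A] N} (hφ : Function.Injective φ) (p : MSpec A) :
    Function.Injective (OreLocalization.mapActionHom p.primeCompl φ) := by
  intro x y h
  obtain ⟨m, f, hf, rfl⟩ := exists_frac p x
  obtain ⟨m', f', hf', rfl⟩ := exists_frac p y
  rw [map_frac, map_frac, frac_eq_iff] at h
  obtain ⟨u, hu, e⟩ := h
  rw [frac_eq_iff]
  exact ⟨u, hu, hφ (by rw [map_smul, map_smul, map_smul, map_smul, e])⟩

theorem mapActionHom_isAdmissibleSurjection {φ : M →[A] N} (hφ : IsAdmissibleSurjection φ)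
    (p : MSpec A) : IsAdmissibleSurjection (OreLocalization.mapActionHom p.primeCompl φ) := by
  constructor
  · intro y
    obtain ⟨n, f, hf, rfl⟩ := exists_frac p y
    obtain ⟨m, rfl⟩ := hφ.1 n
    exact ⟨frac p m f hf, rfl⟩
  · intro x hx y hy h
    obtain ⟨m, f, hf, rfl⟩ := exists_frac p x
    obtain ⟨m', f', hf', rfl⟩ := exists_frac p y
    rw [map_frac, map_frac, frac_eq_iff] at h
    obtain ⟨u, hu, e⟩ := h
    have h0 : φ (u • f' • m) ≠ 0 := by
      intro h0
      refine hx ?_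
      rw [map_frac, ← frac_zero p hf, frac_eq_iff]
      refine ⟨u * f', mul_notMem hu hf', ?_⟩
      rw [map_smul, map_smul] at h0
      rw [smul_zero, smul_zero, smul_comm, mul_smul, h0, smul_zero]
    have e' : φ (u • f' • m) = φ (u • f • m') := by
      rw [map_smul, map_smul, map_smul, map_smul, e]
    rw [frac_eq_iff]
    exact ⟨u, hu, hφ.2 h0 (show φ _ ≠ 0 from e' ▸ h0) e'⟩

theorem frac_closedPoint_bijective [Nontrivial A] : Function.Bijective
    (fun m : M => frac (closedPoint A) m 1 (closedPoint A).one_notMem) := by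
  constructor
  · intro m m' h
    obtain ⟨u, hu, e⟩ := (frac_eq_iff _).1 h
    rw [one_smul, one_smul] at e
    exact (not_not.1 hu).smul_cancel_mulAction e
  · intro x
    obtain ⟨m, f, hf, rfl⟩ := exists_frac _ x
    obtain ⟨g, hg⟩ := (not_not.1 hf : IsUnit f).exists_right_inv
    refine ⟨g • m, (frac_eq_iff _).2 ⟨1, (closedPoint A).one_notMem, ?_⟩⟩
    rw [one_smul, one_smul, one_smul, ← mul_smul, hg, one_smul]

end MSpec

/-- The global section of `M~` that corresponds to an element of `M`. -/
def tildeGlobal (M : AMod A) (m : M.carrier) : (tildeObj M).Γ ⊤ :=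
  fracSection M ⊤ m 1 fun p _ => p.one_notMem

theorem tildeEval_tildeGlobal (M : AMod A) (m : M.carrier) (p : MSpec A)
    (hp : p ∈ (⊤ : Opens (mSpec A).carrier)) :
    tildeEval (tildeGlobal M m) p hp = frac p m 1 p.one_notMem := rfl

theorem AMod.eq_of_subsingleton [Subsingleton A] {M : AMod A} (m m' : M.carrier) : m = m' := by
  rw [← one_smul A m, ← one_smul A m', Subsingleton.elim (1 : A) 0, zero_smul, zero_smul]

theorem tildeGlobal_bijective (M : AMod A) : Function.Bijective (tildeGlobal M) := by
  rcases subsingleton_or_nontrivial A with h | h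
  · exact ⟨fun m m' _ => AMod.eq_of_subsingleton m m', fun s => ⟨0, tildeEval_ext fun p hp =>
      (not_subsingleton_iff_nontrivial.2 (MSpec.nontrivial p) inferInstance).elim⟩⟩
  · constructor
    · intro m m' h
      exact frac_closedPoint_bijective.1
        (congrArg (fun s => tildeEval s (closedPoint A) (Opens.mem_top _)) h)
    · intro s
      obtain ⟨m, hm⟩ := frac_closedPoint_bijective.2
        (tildeEval s (closedPoint A) (Opens.mem_top (α := (mSpec A).carrier) _))
      exact ⟨m, tildeEval_injective (Opens.mem_top (α := (mSpec A).carrier) _)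
        (fun q _ => le_closedPoint q) hm⟩

theorem tildeGlobal_smul (M : AMod A) (a : A) (m : M.carrier) :
    tildeGlobal M (a • m) = mSpecConst ⊤ a • tildeGlobal M m :=
  tildeEval_ext fun p hp => by
    rw [tildeEval_smul, tildeEval_tildeGlobal, tildeEval_tildeGlobal, mSpecEval_mSpecConst,
      frac_smul_frac]
    congr 1
    exact (one_mul 1).symm

instance : (tilde A).Faithful where
  map_injective {M N φ ψ} h := by
    refine MulActionHom.ext fun m => (tildeGlobal_bijective N).1 ?_
    exact congrArg (fun f => OMod.app f ⊤ (tildeGlobal M m)) h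

theorem isMonoidScheme_mSpec : (mSpec A).IsMonoidScheme :=
  fun x => ⟨AffineChart.self A, AffineChart.mem_range_self A x⟩

/-- An isomorphism of sheaves from a trivialization on the identity chart. -/
theorem nonempty_iso_of_restrictionIso {F G : OMod (mSpec A)}
    (e : (OpenImmersion.id (mSpec A)).RestrictionIso F G) : Nonempty (F ≅ G) := by
  have hU (U : Opens (mSpec A).carrier) :
      (U : Set (mSpec A).carrier) ⊆ Set.range (OpenImmersion.id (mSpec A)).map :=
    fun x _ => ⟨x, rfl⟩
  let f : F ⟶ G := OMod.homMk (fun U => e.equiv U (hU U)) (fun i s => e.equiv_res _ _ i s)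
    (fun U => e.map_zero U _) fun U a s => e.map_smul U _ a s
  have := OMod.isIso_of_bijective f fun U => (e.equiv U (hU U)).bijective
  exact ⟨asIso f⟩

variable [AlexandrovDiscrete (mSpec A).carrier]

theorem le_of_mem_core {p q : MSpec A} (h : q ∈ Opens.core (T := (mSpec A).carrier) p) :
    q.asIdeal ⊆ p.asIdeal :=
  (OpenImmersion.id (mSpec A)).pt_mem_nbhd_iff.1 h

theorem isUnit_mSpecConst_core {p : MSpec A} {f : A} (hf : f ∉ p.asIdeal) :
    IsUnit (mSpecConst (Opens.core (T := (mSpec A).carrier) p) f) :=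
  (isUnit_mSpecConst_iff (Opens.mem_core (T := (mSpec A).carrier) p)
    (fun _ => le_of_mem_core) f).2 hf

theorem tildeObj_hom_ext {M N : AMod A} {g g' : tildeObj M ⟶ tildeObj N}
    (hg : ∀ m, OMod.app g ⊤ (tildeGlobal M m) = OMod.app g' ⊤ (tildeGlobal M m)) : g = g' := by
  refine OMod.hom_ext fun U s => OMod.eq_of_res_core_eq _ fun p hp => ?_
  rw [← OMod.app_res, ← OMod.app_res]
  obtain ⟨m, f, h⟩ := exists_tildeEval_eq_frac s hp
  obtain ⟨hf, -⟩ := h p subset_rfl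
  have key : mSpecConst (Opens.core (T := (mSpec A).carrier) p) f •
      (tildeObj M).res (homOfLE (Opens.core_le_iff.2 hp)) s =
      (tildeObj M).res (homOfLE le_top) (tildeGlobal M m) := by
    refine tildeEval_ext fun q hq => ?_
    obtain ⟨hfq, e⟩ := h q (le_of_mem_core hq)
    rw [tildeEval_smul, tildeEval_res, tildeEval_res, mSpecEval_mSpecConst,
      tildeEval_tildeGlobal, e, frac_smul_frac, frac_eq_iff]
    exact ⟨1, q.one_notMem, by rw [one_smul, one_smul, one_smul, one_mul]⟩
  refine (isUnit_mSpecConst_core hf).smul_cancel_mulAction ?_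
  rw [← OMod.app_smul, ← OMod.app_smul, key, OMod.app_res, OMod.app_res, hg]

theorem exists_tilde_map_eq {M N : AMod A} (g : tildeObj M ⟶ tildeObj N) :
    ∃ φ : M ⟶ N, (tilde A).map φ = g := by
  choose φ hφ using fun m => (tildeGlobal_bijective N).2 (OMod.app g ⊤ (tildeGlobal M m))
  let φ' : M ⟶ N := show M.carrier →[A] N.carrier from
    { toFun := φ
      map_smul' := fun a m => (tildeGlobal_bijective N).1 (by
        rw [hφ, tildeGlobal_smul, OMod.app_smul]
        refine Eq.trans ?_ (tildeGlobal_smul N a _).symm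
        rw [hφ]) }
  exact ⟨φ', tildeObj_hom_ext hφ⟩

instance : (tilde A).Full where
  map_surjective := exists_tilde_map_eq

/-- Sections of `M~` over the smallest neighbourhood of `p` are elements of `M_p`. -/
def tildeCoreEquiv (M : AMod A) (p : MSpec A) :
    (tildeObj M).Γ (Opens.core (T := (mSpec A).carrier) p) ≃ localizationAt A M.carrier p :=
  Equiv.ofBijective (fun s => tildeEval s p (Opens.mem_core (T := (mSpec A).carrier) p)) (by
    refine ⟨fun s t h => tildeEval_injective _ (fun _ => le_of_mem_core) h, fun x => ?_⟩
    obtain ⟨m, f, hf, rfl⟩ := exists_frac p x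
    exact ⟨fracSection M _ m f fun q hq h => hf (le_of_mem_core hq h), rfl⟩)

theorem admMono_tilde_map_iff {M N : AMod A} (φ : M ⟶ N) :
    OMod.admMono (mSpec A) ((tilde A).map φ) ↔ AMod.admMono A φ := by
  have h (p : MSpec A) := (OMod.stalkMap_injective_iff ((tilde A).map φ) p).trans
    (injective_congr (tildeCoreEquiv M p) (tildeCoreEquiv N p)
      (g := OreLocalization.mapActionHom p.primeCompl (AMod.Hom.toMap φ)) fun _ => rfl)
  refine ⟨fun hφ => ?_, fun hφ p => (h p).2 (mapActionHom_injective hφ p)⟩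
  rcases subsingleton_or_nontrivial A with _ | _
  · exact fun m m' _ => AMod.eq_of_subsingleton m m'
  · exact (injective_congr
      (g := OreLocalization.mapActionHom (closedPoint A).primeCompl (AMod.Hom.toMap φ))
      (Equiv.ofBijective _ frac_closedPoint_bijective)
      (Equiv.ofBijective _ frac_closedPoint_bijective) fun _ => rfl).2
      ((h (closedPoint A)).1 (hφ _))

theorem admEpi_tilde_map_iff {M N : AMod A} (φ : M ⟶ N) :
    OMod.admEpi (mSpec A) ((tilde A).map φ) ↔ AMod.admEpi A φ := by
  have h (p : MSpec A) := (OMod.stalkMap_isAdmissibleSurjection_iff ((tilde A).map φ) p).trans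
    (isAdmissibleSurjection_congr (tildeCoreEquiv M p) (tildeCoreEquiv N p)
      (g := OreLocalization.mapActionHom p.primeCompl (AMod.Hom.toMap φ)) rfl fun _ => rfl)
  refine ⟨fun hφ => ?_, fun hφ p => (h p).2 (mapActionHom_isAdmissibleSurjection hφ p)⟩
  rcases subsingleton_or_nontrivial A with _ | _
  · exact ⟨fun n => ⟨0, AMod.eq_of_subsingleton _ n⟩,
      fun m _ m' _ _ => AMod.eq_of_subsingleton m m'⟩
  · exact (isAdmissibleSurjection_congr
      (g := OreLocalization.mapActionHom (closedPoint A).primeCompl (AMod.Hom.toMap φ))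
      (Equiv.ofBijective _ frac_closedPoint_bijective)
      (Equiv.ofBijective _ frac_closedPoint_bijective)
      (frac_zero _ (closedPoint A).one_notMem) fun _ => rfl).2 ((h (closedPoint A)).1 (hφ _))

instance : (tildeQcoh A).EssSurj where
  mem_essImage F := by
    obtain ⟨M, ⟨e⟩, -⟩ := (OpenImmersion.id (mSpec A)).exists_restrictionIso
      ((OMod.isQuasicoherent_iff isMonoidScheme_mSpec F.obj).1 F.property)
    obtain ⟨e'⟩ := nonempty_iso_of_restrictionIso e
    exact ⟨M, ⟨ObjectProperty.isoMk _ e'.symm⟩⟩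

instance : (tildeCoh A).EssSurj where
  mem_essImage F := by
    have hF := (OMod.isCoherent_iff isMonoidScheme_mSpec F.obj).1 F.property
    obtain ⟨M, ⟨e⟩, hM⟩ := (OpenImmersion.id (mSpec A)).exists_restrictionIso hF.1
    obtain ⟨e'⟩ := nonempty_iso_of_restrictionIso e
    exact ⟨⟨M, hM hF.2⟩, ⟨ObjectProperty.isoMk _ e'.symm⟩⟩

instance : (tildeQcoh A).IsEquivalence where
  faithful := inferInstanceAs ((OMod.isQuasicoherent (mSpec A)).lift (tilde A) _).Faithful
  full := inferInstanceAs ((OMod.isQuasicoherent (mSpec A)).lift (tilde A) _).Full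

instance : (tildeCoh A).IsEquivalence where
  faithful := inferInstanceAs
    ((OMod.isCoherent (mSpec A)).lift ((AMod.isFG A).ι ⋙ tilde A) _).Faithful
  full := inferInstanceAs ((OMod.isCoherent (mSpec A)).lift ((AMod.isFG A).ι ⋙ tilde A) _).Full

theorem admMono_eq_inverseImage_tildeQcoh : AMod.admMono A =
    (OMod.admMonoIn (OMod.isQuasicoherent (mSpec A))).inverseImage (tildeQcoh A) := by
  ext M N φ
  exact (admMono_tilde_map_iff φ).symm

theorem admEpi_eq_inverseImage_tildeQcoh : AMod.admEpi A =
    (OMod.admEpiIn (OMod.isQuasicoherent (mSpec A))).inverseImage (tildeQcoh A) := by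
  ext M N φ
  exact (admEpi_tilde_map_iff φ).symm

theorem admMonoFG_eq_inverseImage_tildeCoh : AMod.admMonoFG A =
    (OMod.admMonoIn (OMod.isCoherent (mSpec A))).inverseImage (tildeCoh A) := by
  ext M N φ
  exact (admMono_tilde_map_iff φ.hom).symm

theorem admEpiFG_eq_inverseImage_tildeCoh : AMod.admEpiFG A =
    (OMod.admEpiIn (OMod.isCoherent (mSpec A))).inverseImage (tildeCoh A) := by
  ext M N φ
  exact (admEpi_tilde_map_iff φ.hom).symm

end TildeEquivalence

end

theorem proposition3p8 :
    (∀ X : MonoidalSpace.{u}, X.IsMonoidScheme → X.IsFiniteType →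
      (OMod.IsProtoExactSubcategory (OMod.isQuasicoherent X) ∧
        OMod.IsProtoExactSubcategory (OMod.isCoherent X)) ∧
      (∀ Z : Set X.carrier, IsClosed Z →
        OMod.IsProtoExactSubcategory (OMod.isQuasicoherent X ⊓ OMod.isSupportedIn Z) ∧
        OMod.IsProtoExactSubcategory (OMod.isCoherent X ⊓ OMod.isSupportedIn Z)) ∧
      (∀ I : OMod.IdealSheaf X, OMod.isQuasicoherent X I.toOMod →
        (OMod.IsProtoExactSubcategory (OMod.isQuasicoherent X ⊓ OMod.isAnnihilatedBy I) ∧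
          IsExactFunctor
            (OMod.admMonoIn (OMod.isQuasicoherent X ⊓ OMod.isAnnihilatedBy I))
            (OMod.admEpiIn (OMod.isQuasicoherent X ⊓ OMod.isAnnihilatedBy I))
            (OMod.admMonoIn (OMod.isQuasicoherent X))
            (OMod.admEpiIn (OMod.isQuasicoherent X))
            (ObjectProperty.ιOfLE inf_le_left)) ∧
        (OMod.IsProtoExactSubcategory (OMod.isCoherent X ⊓ OMod.isAnnihilatedBy I) ∧
          IsExactFunctor
            (OMod.admMonoIn (OMod.isCoherent X ⊓ OMod.isAnnihilatedBy I))
            (OMod.admEpiIn (OMod.isCoherent X ⊓ OMod.isAnnihilatedBy I))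
            (OMod.admMonoIn (OMod.isCoherent X))
            (OMod.admEpiIn (OMod.isCoherent X))
            (ObjectProperty.ιOfLE inf_le_left)))) ∧
    (∀ (A : Type u) [CommMonoidWithZero A], (mSpec A).IsFiniteType →
      (IsProtoExact (AMod.admMono A) (AMod.admEpi A) ∧
        IsExactEquivalence (AMod.admMono A) (AMod.admEpi A)
          (OMod.admMonoIn (OMod.isQuasicoherent (mSpec A)))
          (OMod.admEpiIn (OMod.isQuasicoherent (mSpec A))) (tildeQcoh A)) ∧
      (IsProtoExact (AMod.admMonoFG A) (AMod.admEpiFG A) ∧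
        IsExactEquivalence (AMod.admMonoFG A) (AMod.admEpiFG A)
          (OMod.admMonoIn (OMod.isCoherent (mSpec A)))
          (OMod.admEpiIn (OMod.isCoherent (mSpec A))) (tildeCoh A))) := by
  refine ⟨fun X hX hX' => ?_, fun A _ hA => ?_⟩
  · have := hX'.finite
    refine ⟨⟨OMod.isProtoExactSubcategory (OMod.isAdmissiblyClosed_isQuasicoherent hX),
      OMod.isProtoExactSubcategory (OMod.isAdmissiblyClosed_isCoherent hX hX')⟩,
      fun Z _ => ⟨?_, ?_⟩, fun I _ => ⟨⟨?_, ?_⟩, ⟨?_, ?_⟩⟩⟩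
    · exact OMod.isProtoExactSubcategory
        (OMod.isAdmissiblyClosed_isQuasicoherent_inf hX (OMod.isSerre_isSupportedIn Z))
    · exact OMod.isProtoExactSubcategory
        (OMod.isAdmissiblyClosed_isCoherent_inf hX hX' (OMod.isSerre_isSupportedIn Z))
    · exact OMod.isProtoExactSubcategory
        (OMod.isAdmissiblyClosed_isQuasicoherent_inf hX (OMod.isSerre_isAnnihilatedBy I))
    · exact (OMod.isProtoExact X).isExactFunctor_ιOfLE _
        (OMod.isAdmissiblyClosed_isQuasicoherent_inf hX (OMod.isSerre_isAnnihilatedBy I))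
    · exact OMod.isProtoExactSubcategory
        (OMod.isAdmissiblyClosed_isCoherent_inf hX hX' (OMod.isSerre_isAnnihilatedBy I))
    · exact (OMod.isProtoExact X).isExactFunctor_ιOfLE _
        (OMod.isAdmissiblyClosed_isCoherent_inf hX hX' (OMod.isSerre_isAnnihilatedBy I))
  · have := hA.finite
    have hQ : OMod.IsProtoExactSubcategory (OMod.isQuasicoherent (mSpec A)) :=
      OMod.isProtoExactSubcategory (OMod.isAdmissiblyClosed_isQuasicoherent isMonoidScheme_mSpec)
    have hC : OMod.IsProtoExactSubcategory (OMod.isCoherent (mSpec A)) :=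
      OMod.isProtoExactSubcategory (OMod.isAdmissiblyClosed_isCoherent isMonoidScheme_mSpec hA)
    rw [admMono_eq_inverseImage_tildeQcoh, admEpi_eq_inverseImage_tildeQcoh,
      admMonoFG_eq_inverseImage_tildeCoh, admEpiFG_eq_inverseImage_tildeCoh]
    exact ⟨⟨hQ.inverseImage (.of_isEquivalence _ _ _), hQ.isExactEquivalence inferInstance⟩,
      ⟨hC.inverseImage (.of_isEquivalence _ _ _), hC.isExactEquivalence inferInstance⟩⟩
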